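/- For real numbers $a>b>c>d>0$ let $$E(a)=E(a,b,c,d)=\Big\{x\in\mathbb{R}^4:\ \frac{x_1^2}{a^2}+\frac{x_2^2}{b^2}+\frac{x_3^2}{c^2}+\frac{x_4^2}{d^2}=1\Big\},\qquad \Gamma_2(a)=E(a)\cap\{x_2=0\},$$ with the Riemannian metrics induced from $\mathbb{R}^4$. The Morse index of the surface $\Gamma_2(a)\subset E(a)$ is the maximal dimension of a linear subspace of $C^\infty(\Gamma_2(a))$ on which the stability operator $L=-\Delta-|A|^2-\mathrm{Ric}(\nu,\nu)$ is negative definite, i.e. $\int_{\Gamma_2(a)}\varphi\,L\varphi<0$ for all $\varphi\neq 0$ in the subspace; here $\Delta$ is the Laplace–Beltrami operator of $\Gamma_2(a)$, $A$ and $\nu$ are the second fundamental form and a unit normal of $\Gamma_2(a)$ in $E(a)$, $\mathrm{Ric}$ is the Ricci curvature of $E(a)$, and the integral is with respect to area. Then for all fixed $b>c>d>0$ there is $a_0=a_0(b,c,d)>b$ such that for every $a>a_0$ the Morse index of $\Gamma_2(a)$ in $E(a)$ is greater than $2$. -/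

import Mathlib

open scoped ContDiff MeasureTheory

noncomputable section

namespace SubmanifoldGeometry

/-! Riemannian geometry of smooth embedded submanifolds `M` of Euclidean space, with the metric
induced from the Euclidean inner product.  A submanifold is given by its underlying set; functions
and vector fields on `M` are represented by functions on the ambient space, of which only the
values on `M` are ever used. -/

variable {n : ℕ}

/-- The tangent space `T_p M`, as a linear subspace of the ambient Euclidean space. -/
def tangentSpace (M : Set (EuclideanSpace ℝ (Fin n))) (p : EuclideanSpace ℝ (Fin n)) :
    Submodule ℝ (EuclideanSpace ℝ (Fin n)) :=
  Submodule.span ℝ (tangentConeAt ℝ M p)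

/-- The orthogonal projection of the ambient space onto `T_p M`. -/
def tangentProj (M : Set (EuclideanSpace ℝ (Fin n))) (p : EuclideanSpace ℝ (Fin n)) :
    EuclideanSpace ℝ (Fin n) →L[ℝ] EuclideanSpace ℝ (Fin n) :=
  (tangentSpace M p).starProjection

/-- An orthonormal basis of `T_p M`, used to take traces. -/
def tangentBasis (M : Set (EuclideanSpace ℝ (Fin n))) (p : EuclideanSpace ℝ (Fin n)) :
    OrthonormalBasis (Fin (Module.finrank ℝ (tangentSpace M p))) ℝ (tangentSpace M p) :=
  stdOrthonormalBasis ℝ (tangentSpace M p)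

/-- The Levi-Civita connection of the induced metric on `M`: for vector fields `U`, `X` tangent
to `M`, the field `∇_U X` is the tangential part of the Euclidean derivative of `X` along `M` in
the direction `U`.  (The derivative within `M` is evaluated on vectors tangent to `M` only, where
it is uniquely determined by the values of `X` on `M`.) -/
def leviCivita (M : Set (EuclideanSpace ℝ (Fin n)))
    (U X : EuclideanSpace ℝ (Fin n) → EuclideanSpace ℝ (Fin n)) :
    EuclideanSpace ℝ (Fin n) → EuclideanSpace ℝ (Fin n) :=
  fun p => tangentProj M p (fderivWithin ℝ X M p (U p))

/-- The tangent vector field `p ↦ P_p v` on `M`.  If `v ∈ T_p M`, its value at `p` is `v`; it serves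
as an extension of a tangent vector to a tangent vector field. -/
def tangentExt (M : Set (EuclideanSpace ℝ (Fin n))) (v : EuclideanSpace ℝ (Fin n)) :
    EuclideanSpace ℝ (Fin n) → EuclideanSpace ℝ (Fin n) :=
  fun p => tangentProj M p v

/-- The Riemann curvature tensor of the induced metric,
`R(u,v)w = ∇_u ∇_v w - ∇_v ∇_u w - ∇_{[u,v]} w`, at the point `p`; the tangent vectors `u, v, w` at
`p` are extended to tangent vector fields (the value does not depend on the extensions). -/
def riemann (M : Set (EuclideanSpace ℝ (Fin n))) (p u v w : EuclideanSpace ℝ (Fin n)) :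
    EuclideanSpace ℝ (Fin n) :=
  leviCivita M (tangentExt M u) (leviCivita M (tangentExt M v) (tangentExt M w)) p
    - leviCivita M (tangentExt M v) (leviCivita M (tangentExt M u) (tangentExt M w)) p
    - leviCivita M (VectorField.lieBracketWithin ℝ (tangentExt M u) (tangentExt M v) M)
        (tangentExt M w) p

/-- The Ricci curvature of the induced metric: `Ric(v,w)` is the trace of `u ↦ R(u,v)w` on
`T_p M`. -/
def ricci (M : Set (EuclideanSpace ℝ (Fin n))) (p v w : EuclideanSpace ℝ (Fin n)) : ℝ :=
  ∑ i, inner ℝ (riemann M p (tangentBasis M p i) v w)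
    (tangentBasis M p i : EuclideanSpace ℝ (Fin n))

/-- The gradient on `Γ` of a function on `Γ`: the tangential part of the Euclidean gradient. -/
def grad (Γ : Set (EuclideanSpace ℝ (Fin n))) (f : EuclideanSpace ℝ (Fin n) → ℝ) :
    EuclideanSpace ℝ (Fin n) → EuclideanSpace ℝ (Fin n) :=
  fun p => tangentProj Γ p (gradientWithin f Γ p)

/-- The Laplace-Beltrami operator of `Γ`: the divergence `∑ ⟨∇_{e_i} grad f, e_i⟩` of the
gradient. -/
def laplacian (Γ : Set (EuclideanSpace ℝ (Fin n))) (f : EuclideanSpace ℝ (Fin n) → ℝ)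
    (p : EuclideanSpace ℝ (Fin n)) : ℝ :=
  ∑ i, inner ℝ (leviCivita Γ (tangentExt Γ (tangentBasis Γ p i)) (grad Γ f) p)
    (tangentBasis Γ p i : EuclideanSpace ℝ (Fin n))

/-- The second fundamental form `A(u,v)` at `p` of a submanifold `Γ` of `M`: the component of
`∇^M_u v` normal to `Γ`, where `v` is extended to a tangent vector field of `Γ`. -/
def secondFundamentalForm (M Γ : Set (EuclideanSpace ℝ (Fin n)))
    (p u v : EuclideanSpace ℝ (Fin n)) : EuclideanSpace ℝ (Fin n) :=
  tangentProj M p (fderivWithin ℝ (tangentExt Γ v) Γ p u)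
    - tangentProj Γ p (fderivWithin ℝ (tangentExt Γ v) Γ p u)

/-- The squared norm `|A|²` of the second fundamental form of `Γ` in `M`. -/
def normSqSecondFundamentalForm (M Γ : Set (EuclideanSpace ℝ (Fin n)))
    (p : EuclideanSpace ℝ (Fin n)) : ℝ :=
  ∑ i, ∑ j, ‖secondFundamentalForm M Γ p (tangentBasis Γ p i) (tangentBasis Γ p j)‖ ^ 2

/-- `ν` is a unit normal vector at `p` of the submanifold `Γ` of `M`. -/
def IsUnitNormal (M Γ : Set (EuclideanSpace ℝ (Fin n))) (p ν : EuclideanSpace ℝ (Fin n)) : Prop :=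
  ν ∈ tangentSpace M p ∧ ν ∈ (tangentSpace Γ p)ᗮ ∧ ‖ν‖ = 1

open Classical in
/-- A unit normal vector at `p` of the hypersurface `Γ` of `M`.  (It is determined up to sign, and
enters below only through the quadratic expression `Ric(ν,ν)`.) -/
def unitNormal (M Γ : Set (EuclideanSpace ℝ (Fin n))) (p : EuclideanSpace ℝ (Fin n)) :
    EuclideanSpace ℝ (Fin n) :=
  if h : ∃ ν, IsUnitNormal M Γ p ν then h.choose else 0

/-- The stability (Jacobi) operator `L f = -Δ f - |A|² f - Ric(ν,ν) f` of a hypersurface `Γ` of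
`M`. -/
def stabilityOperator (M Γ : Set (EuclideanSpace ℝ (Fin n)))
    (f : EuclideanSpace ℝ (Fin n) → ℝ) (p : EuclideanSpace ℝ (Fin n)) : ℝ :=
  - laplacian Γ f p - normSqSecondFundamentalForm M Γ p * f p
    - ricci M p (unitNormal M Γ p) (unitNormal M Γ p) * f p

/-- The real vector space `C^∞(Γ)` for a closed submanifold `Γ`: functions on `Γ` that are
restrictions of smooth functions on the ambient space. -/
def smoothFunctions (Γ : Set (EuclideanSpace ℝ (Fin n))) : Submodule ℝ (Γ → ℝ) where
  carrier := {φ | ∃ F : EuclideanSpace ℝ (Fin n) → ℝ, ContDiff ℝ ∞ F ∧ ∀ p : Γ, F p = φ p}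
  zero_mem' := ⟨fun _ => 0, contDiff_const, fun _ => rfl⟩
  add_mem' := by
    rintro φ ψ ⟨F, hF, hφ⟩ ⟨G, hG, hψ⟩
    exact ⟨fun x => F x + G x, hF.add hG, fun p => by simp [hφ, hψ]⟩
  smul_mem' := by
    rintro c φ ⟨F, hF, hφ⟩
    exact ⟨fun x => c * F x, contDiff_const.mul hF, fun p => by simp [hφ]⟩

/-- A function on `Γ`, represented by the function on the ambient space that vanishes off `Γ`. -/
def extendByZero {Γ : Set (EuclideanSpace ℝ (Fin n))} (φ : Γ → ℝ) :
    EuclideanSpace ℝ (Fin n) → ℝ :=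
  Function.extend Subtype.val φ 0

/-- The quadratic form `∫_Γ φ L φ` of a surface `Γ` of `M`, integrated with respect to the area
measure (two-dimensional Hausdorff measure) of `Γ`. -/
def stabilityForm (M Γ : Set (EuclideanSpace ℝ (Fin n))) (φ : Γ → ℝ) : ℝ :=
  ∫ p in Γ, extendByZero φ p * stabilityOperator M Γ (extendByZero φ) p ∂μHE[2]

/-- The Morse index of a closed surface `Γ` in `M` (a three-manifold): the maximal dimension of a
subspace of `C^∞(Γ)` on which the stability operator is negative definite. -/
def morseIndex (M Γ : Set (EuclideanSpace ℝ (Fin n))) : ℕ∞ :=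
  ⨆ (S : Submodule ℝ (smoothFunctions Γ)) (_ : FiniteDimensional ℝ S)
    (_ : ∀ φ ∈ S, φ ≠ 0 → stabilityForm M Γ (φ : Γ → ℝ) < 0), (Module.finrank ℝ S : ℕ∞)

end SubmanifoldGeometry

/-- The ellipsoid `E(a,b,c,d) = {x₁²/a² + x₂²/b² + x₃²/c² + x₄²/d² = 1}` in `ℝ⁴`. -/
def ellipsoid (a b c d : ℝ) : Set (EuclideanSpace ℝ (Fin 4)) :=
  {x | x 0 ^ 2 / a ^ 2 + x 1 ^ 2 / b ^ 2 + x 2 ^ 2 / c ^ 2 + x 3 ^ 2 / d ^ 2 = 1}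

/-- The second planar sphere `Γ₂ = E(a,b,c,d) ∩ {x₂ = 0}` (the coordinate `x₂` has index `1`). -/
def planarSphereTwo (a b c d : ℝ) : Set (EuclideanSpace ℝ (Fin 4)) :=
  ellipsoid a b c d ∩ {x | x 1 = 0}

end

/-! The surface `Γ₂` is a section of the quadric `{⟨A x, x⟩ = 1}` by an invariant hyperplane, so it
is totally geodesic with normal `±e₁`. By the Gauss equation (`riemann_quadric`, `ricci_quadric`) its
Ricci term is `Ric(ν, ν) = τ / b²`, where `τ` is the mean curvature of `Γ₂` in the hyperplane,
divided by `|A p|`. On functions `F(x₀)` of the long coordinate the stability operator is therefore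
(`stabilityOperator_quadric`)

  `L F = -F'' |∇x₀|² + τ (x₀ F' / a² - F / b²)`.

In the variable `s = x₀ / a` the first two terms carry a factor `1 / a²`, and the ratio `|∇x₀|² / τ`
is bounded independently of `a` (`curvature_bounds`), so that the negative zeroth order term
dominates for large `a`, except near the zeros of `F`. Three functions of the form `exp (-1 / h(s))`,
where `h` is a polynomial, with disjoint supports are used as test functions. They are convex near
the edge of the support, with `F''` much larger than `F'` and `F`, which settles the sign of `F L F`
there too, and `F L F < 0` holds wherever `F ≠ 0` (`exists_gluePoly_bound`,
`exists_bumpRatio_neg`).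

As the supports are disjoint, the density `f L f` of any nontrivial linear combination `f` is
nonpositive, and negative on a relatively open set (`energyDensity_eq_sum`). No integration by parts
and no area formula is needed: it is enough that `Γ₂` has finite area, being covered by a Lipschitz
image of a disc, and that relatively open subsets have positive area, since their projection to a coordinate
plane contains an open set. So the form is negative definite on a three-dimensional space
(`le_morseIndex`). -/

open scoped ContDiff MeasureTheory
open MeasureTheory

noncomputable section

namespace SubmanifoldGeometry

/-! ### Quadrics -/

variable {n : ℕ}

/-- The quadric `{x ∈ K : ⟨A x, x⟩ = 1}` cut out of the linear subspace `K` by the quadratic form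
of `A`. -/
def quadric (A : EuclideanSpace ℝ (Fin n) →L[ℝ] EuclideanSpace ℝ (Fin n))
    (K : Submodule ℝ (EuclideanSpace ℝ (Fin n))) : Set (EuclideanSpace ℝ (Fin n)) :=
  {x | x ∈ K ∧ inner ℝ (A x) x = 1}

/-- The coefficient `⟨w, A q⟩ / |A q|²` of the normal direction `A q` in `w`. -/
def normalCoeff (A : EuclideanSpace ℝ (Fin n) →L[ℝ] EuclideanSpace ℝ (Fin n))
    (w q : EuclideanSpace ℝ (Fin n)) : ℝ :=
  inner ℝ w (A q) * (inner ℝ (A q) (A q))⁻¹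

/-- The hypotheses on `A` and `K` under which `quadric A K` is a compact hypersurface of `K` with
normal direction `A q` at `q`. -/
structure IsEllipsoidal (A : EuclideanSpace ℝ (Fin n) →L[ℝ] EuclideanSpace ℝ (Fin n))
    (K : Submodule ℝ (EuclideanSpace ℝ (Fin n))) : Prop where
  symm : ∀ x y, inner ℝ (A x) y = inner ℝ x (A y)
  pos : ∀ x, x ≠ 0 → 0 < inner ℝ (A x) x
  map_mem : ∀ x ∈ K, A x ∈ K

variable {A : EuclideanSpace ℝ (Fin n) →L[ℝ] EuclideanSpace ℝ (Fin n)}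
  {K : Submodule ℝ (EuclideanSpace ℝ (Fin n))} {p : EuclideanSpace ℝ (Fin n)}

/-! ### Tangent spaces and projections of quadrics -/

lemma apply_ne_zero_of_mem_quadric (hp : p ∈ quadric A K) : A p ≠ 0 := by
  intro h
  have := hp.2
  simp [h] at this

lemma inner_apply_self_pos_of_mem_quadric (hp : p ∈ quadric A K) :
    0 < inner ℝ (A p) (A p) :=
  real_inner_self_pos.2 (apply_ne_zero_of_mem_quadric hp)

lemma fderivWithin_eq_on_tangentSpace {F : Type*} [NormedAddCommGroup F]
    [NormedSpace ℝ F] {M : Set (EuclideanSpace ℝ (Fin n))} {f : EuclideanSpace ℝ (Fin n) → F}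
    {f' : EuclideanSpace ℝ (Fin n) →L[ℝ] F} (hf : HasFDerivWithinAt f f' M p)
    {v : EuclideanSpace ℝ (Fin n)} (hv : v ∈ tangentSpace M p) :
    fderivWithin ℝ f M p v = f' v := by
  have h := hf.differentiableWithinAt.hasFDerivWithinAt.unique_on hf
  exact LinearMap.eqOn_span (f := (fderivWithin ℝ f M p).toLinearMap) (g := f'.toLinearMap) h hv

/-- A vector `v ∈ K` with `⟨A p, v⟩ = 0` is the velocity at `t = 0` of the curve
`t ↦ (p + t v) / √(1 + t² ⟨A v, v⟩)` in the quadric. -/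
lemma tangentSpace_quadric (h : IsEllipsoidal A K) (hp : p ∈ quadric A K) :
    tangentSpace (quadric A K) p = K ⊓ (ℝ ∙ A p)ᗮ := by
  apply le_antisymm
  · rw [tangentSpace, Submodule.span_le]
    intro v hv
    refine ⟨?_, Submodule.mem_orthogonal_singleton_iff_inner_right.2 ?_⟩
    · have h0 : HasFDerivWithinAt (fun x => Kᗮ.starProjection x) Kᗮ.starProjection
          (quadric A K) p := Kᗮ.starProjection.hasFDerivWithinAt
      have h1 : HasFDerivWithinAt (fun x => Kᗮ.starProjection x)
          (0 : EuclideanSpace ℝ (Fin n) →L[ℝ] EuclideanSpace ℝ (Fin n)) (quadric A K) p := by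
        refine (hasFDerivWithinAt_const (0 : EuclideanSpace ℝ (Fin n)) p _).congr ?_ ?_
        · intro x hx
          exact (Submodule.starProjection_apply_eq_zero_iff _).2
            (K.le_orthogonal_orthogonal hx.1)
        · exact (Submodule.starProjection_apply_eq_zero_iff _).2
            (K.le_orthogonal_orthogonal hp.1)
      have h2 := h0.unique_on h1 hv
      have h3 := (Submodule.starProjection_apply_eq_zero_iff _).1 h2
      rwa [Submodule.orthogonal_orthogonal] at h3
    · have h0 : HasFDerivWithinAt (fun x => inner ℝ (A x) x) _ (quadric A K) p :=
        (A.hasFDerivAt.inner ℝ (hasFDerivAt_id p)).hasFDerivWithinAt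
      have h1 : HasFDerivWithinAt (fun x => inner ℝ (A x) x)
          (0 : EuclideanSpace ℝ (Fin n) →L[ℝ] ℝ) (quadric A K) p :=
        (hasFDerivWithinAt_const (1 : ℝ) p _).congr (fun x hx => hx.2) hp.2
      have h2 := h0.unique_on h1 hv
      simp only [ContinuousLinearMap.comp_apply, ContinuousLinearMap.prod_apply,
        fderivInnerCLM_apply, id_eq, ContinuousLinearMap.id_apply,
        zero_apply, h.symm v p, real_inner_comm (A p) v] at h2
      linarith
  · rintro v ⟨hvK, hv⟩
    have hv' : inner ℝ (A p) v = 0 := Submodule.mem_orthogonal_singleton_iff_inner_right.1 hv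
    refine Submodule.subset_span ?_
    have hv0 : 0 ≤ inner ℝ (A v) v := by
      by_cases h0 : v = 0
      · simp [h0]
      · exact (h.pos v h0).le
    have hden (t : ℝ) : 0 < 1 + t ^ 2 * inner ℝ (A v) v := by positivity
    let γ : ℝ → EuclideanSpace ℝ (Fin n) := fun t =>
      (Real.sqrt (1 + t ^ 2 * inner ℝ (A v) v))⁻¹ • (p + t • v)
    have hγ : HasDerivAt γ v 0 := by
      have h1 : HasDerivAt (fun t : ℝ => (Real.sqrt (1 + t ^ 2 * inner ℝ (A v) v))⁻¹) 0 0 := by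
        have h2 : HasDerivAt (fun t : ℝ => 1 + t ^ 2 * inner ℝ (A v) v) 0 0 := by
          simpa using (((hasDerivAt_id (0 : ℝ)).pow 2).mul_const (inner ℝ (A v) v)).const_add 1
        have h3 := (h2.sqrt (hden 0).ne').inv (Real.sqrt_ne_zero'.2 (hden 0))
        exact h3.congr_deriv (by simp)
      have h2 : HasDerivAt (fun t : ℝ => p + t • v) v 0 := by
        simpa using ((hasDerivAt_id (0 : ℝ)).smul_const v).const_add p
      exact (h1.smul h2).congr_deriv (by simp)
    have hmem (t : ℝ) : γ t ∈ quadric A K := by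
      refine ⟨K.smul_mem _ (K.add_mem hp.1 (K.smul_mem _ hvK)), ?_⟩
      have h1 : inner ℝ (A v) p = 0 := by rw [h.symm, real_inner_comm, hv']
      simp only [γ, map_smul, map_add, inner_smul_left, inner_smul_right, inner_add_left,
        inner_add_right, hp.2, hv', h1, conj_trivial]
      have h2 : (Real.sqrt (1 + t ^ 2 * inner ℝ (A v) v))⁻¹ *
          (Real.sqrt (1 + t ^ 2 * inner ℝ (A v) v))⁻¹ = (1 + t ^ 2 * inner ℝ (A v) v)⁻¹ := by
        rw [← mul_inv, Real.mul_self_sqrt (hden t).le]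
      calc _ = ((Real.sqrt (1 + t ^ 2 * inner ℝ (A v) v))⁻¹ *
          (Real.sqrt (1 + t ^ 2 * inner ℝ (A v) v))⁻¹) * (1 + t ^ 2 * inner ℝ (A v) v) := by ring
        _ = 1 := by rw [h2, inv_mul_cancel₀ (hden t).ne']
    have h1 := (hγ.hasFDerivAt.hasFDerivWithinAt (s := Set.univ)).mapsTo_tangent_cone
      (show (1 : ℝ) ∈ tangentConeAt ℝ Set.univ (0 : ℝ) by simp)
    have h2 : γ 0 = p := by simp [γ]
    rw [h2] at h1
    simp only [ContinuousLinearMap.toSpanSingleton_apply, one_smul] at h1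
    refine tangentConeAt_mono ?_ h1
    rintro _ ⟨t, -, rfl⟩
    exact hmem t

lemma mem_tangentSpace_quadric (h : IsEllipsoidal A K) (hp : p ∈ quadric A K)
    {v : EuclideanSpace ℝ (Fin n)} :
    v ∈ tangentSpace (quadric A K) p ↔ v ∈ K ∧ inner ℝ v (A p) = 0 := by
  rw [tangentSpace_quadric h hp, Submodule.mem_inf,
    Submodule.mem_orthogonal_singleton_iff_inner_left]

lemma tangentProj_quadric (h : IsEllipsoidal A K) (hp : p ∈ quadric A K)
    (w : EuclideanSpace ℝ (Fin n)) :
    tangentProj (quadric A K) p w = K.starProjection w - normalCoeff A w p • A p := by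
  have hV := inner_apply_self_pos_of_mem_quadric hp
  have hpK := h.map_mem p hp.1
  have hort (x : EuclideanSpace ℝ (Fin n)) (hx : x ∈ K) :
      inner ℝ (w - K.starProjection w) x = 0 := K.starProjection_inner_eq_zero w x hx
  refine Submodule.eq_starProjection_of_mem_of_inner_eq_zero
    ((mem_tangentSpace_quadric h hp).2 ⟨?_, ?_⟩) ?_
  · exact K.sub_mem (K.starProjection_apply_mem w) (K.smul_mem _ hpK)
  · have h1 := hort _ hpK
    rw [inner_sub_left] at h1
    rw [inner_sub_left, inner_smul_left, normalCoeff]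
    simp only [conj_trivial]
    rw [mul_assoc, inv_mul_cancel₀ hV.ne']
    linarith
  · intro x hx
    obtain ⟨hxK, hx0⟩ := (mem_tangentSpace_quadric h hp).1 hx
    have h1 := hort _ hxK
    rw [real_inner_comm] at hx0
    rw [inner_sub_left] at h1 ⊢
    rw [inner_sub_left, inner_smul_left, hx0]
    linarith

lemma tangentProj_mem (M : Set (EuclideanSpace ℝ (Fin n))) (p w : EuclideanSpace ℝ (Fin n)) :
    tangentProj M p w ∈ tangentSpace M p :=
  Submodule.starProjection_apply_mem _ _

lemma tangentProj_eq_self {M : Set (EuclideanSpace ℝ (Fin n))} {w : EuclideanSpace ℝ (Fin n)}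
    (hw : w ∈ tangentSpace M p) : tangentProj M p w = w :=
  Submodule.starProjection_eq_self_iff.2 hw

lemma tangentProj_normal (h : IsEllipsoidal A K) (hp : p ∈ quadric A K) :
    tangentProj (quadric A K) p (A p) = 0 := by
  refine (Submodule.starProjection_apply_eq_zero_iff _).2 ?_
  rw [Submodule.mem_orthogonal]
  exact fun u hu => ((mem_tangentSpace_quadric h hp).1 hu).2

lemma inner_tangentProj_left (M : Set (EuclideanSpace ℝ (Fin n)))
    {v : EuclideanSpace ℝ (Fin n)} (hv : v ∈ tangentSpace M p) (w : EuclideanSpace ℝ (Fin n)) :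
    inner ℝ (tangentProj M p w) v = inner ℝ w v := by
  rw [tangentProj, Submodule.inner_starProjection_left_eq_right,
    Submodule.starProjection_eq_self_iff.2 hv]

lemma normalCoeff_eq_zero (h : IsEllipsoidal A K) (hp : p ∈ quadric A K)
    {w : EuclideanSpace ℝ (Fin n)} (hw : w ∈ tangentSpace (quadric A K) p) :
    normalCoeff A w p = 0 := by
  rw [normalCoeff, ((mem_tangentSpace_quadric h hp).1 hw).2, zero_mul]

/-! ### Levi-Civita connection and curvature of quadrics -/

lemma differentiableAt_normalCoeff_comp (hp : A p ≠ 0)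
    {Y : EuclideanSpace ℝ (Fin n) → EuclideanSpace ℝ (Fin n)} (hY : DifferentiableAt ℝ Y p) :
    DifferentiableAt ℝ (fun q => normalCoeff A (Y q) q) p :=
  (hY.inner ℝ A.differentiableAt).mul
    ((A.differentiableAt.inner ℝ A.differentiableAt).inv (real_inner_self_pos.2 hp).ne')

lemma differentiableAt_normalCoeff (hp : A p ≠ 0) (w : EuclideanSpace ℝ (Fin n)) :
    DifferentiableAt ℝ (normalCoeff A w) p :=
  differentiableAt_normalCoeff_comp hp (differentiableAt_const w)

/-- Where the normal coefficient of `w` vanishes, only the numerator contributes to its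
derivative. -/
lemma fderiv_normalCoeff (hp : A p ≠ 0) {w : EuclideanSpace ℝ (Fin n)}
    (hw : inner ℝ w (A p) = 0) (u : EuclideanSpace ℝ (Fin n)) :
    fderiv ℝ (normalCoeff A w) p u = inner ℝ w (A u) * (inner ℝ (A p) (A p))⁻¹ := by
  have h0 : inner ℝ (A p) (A p) ≠ 0 := (real_inner_self_pos.2 hp).ne'
  have h1 : HasFDerivAt (fun q => inner ℝ w (A q)) ((innerSL ℝ w).comp A) p :=
    ((innerSL ℝ w).comp A).hasFDerivAt
  have h2 : DifferentiableAt ℝ (fun q => (inner ℝ (A q) (A q))⁻¹) p :=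
    (A.differentiableAt.inner ℝ A.differentiableAt).inv h0
  have h3 := (h1.mul h2.hasFDerivAt).fderiv
  change fderiv ℝ (normalCoeff A w) p = _ at h3
  rw [h3]
  simp [hw, mul_comm]

/-- The derivative of the field `q ↦ P_q w` along the quadric. -/
lemma hasFDerivWithinAt_tangentExt (h : IsEllipsoidal A K) (hp : p ∈ quadric A K)
    (w : EuclideanSpace ℝ (Fin n)) :
    HasFDerivWithinAt (tangentExt (quadric A K) w)
      (-(normalCoeff A w p • A + (fderiv ℝ (normalCoeff A w) p).smulRight (A p)))
      (quadric A K) p := by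
  have h1 := (differentiableAt_normalCoeff (apply_ne_zero_of_mem_quadric hp) w).hasFDerivAt.smul
    (A.hasFDerivAt (x := p))
  have h2 := (h1.const_sub (K.starProjection w)).hasFDerivWithinAt (s := quadric A K)
  exact h2.congr (fun q hq => tangentProj_quadric h hq w) (tangentProj_quadric h hp w)

lemma fderivWithin_tangentExt (h : IsEllipsoidal A K) (hp : p ∈ quadric A K)
    (w : EuclideanSpace ℝ (Fin n)) {u : EuclideanSpace ℝ (Fin n)}
    (hu : u ∈ tangentSpace (quadric A K) p) :
    fderivWithin ℝ (tangentExt (quadric A K) w) (quadric A K) p u =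
      -(normalCoeff A w p • A u + fderiv ℝ (normalCoeff A w) p u • A p) := by
  rw [fderivWithin_eq_on_tangentSpace (hasFDerivWithinAt_tangentExt h hp w) hu]
  rfl

/-- The covariant derivative of the tangential part of the constant field `w` is the shape operator
scaled by the normal component of `w`. -/
lemma leviCivita_tangentExt (h : IsEllipsoidal A K) (hp : p ∈ quadric A K)
    (u w : EuclideanSpace ℝ (Fin n)) :
    leviCivita (quadric A K) (tangentExt (quadric A K) u) (tangentExt (quadric A K) w) p =
      -(normalCoeff A w p •
        tangentProj (quadric A K) p (A (tangentExt (quadric A K) u p))) := by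
  have hu : tangentExt (quadric A K) u p ∈ tangentSpace (quadric A K) p := tangentProj_mem _ _ _
  rw [leviCivita, fderivWithin_tangentExt h hp w hu, map_neg, map_add,
    map_smul, map_smul, tangentProj_normal h hp, smul_zero, add_zero]

lemma hasFDerivWithinAt_leviCivita_tangentExt (h : IsEllipsoidal A K) (hp : p ∈ quadric A K)
    {v w : EuclideanSpace ℝ (Fin n)} (hv : v ∈ tangentSpace (quadric A K) p)
    (hw : w ∈ tangentSpace (quadric A K) p) :
    HasFDerivWithinAt
      (leviCivita (quadric A K) (tangentExt (quadric A K) v) (tangentExt (quadric A K) w))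
      (-((fderiv ℝ (normalCoeff A w) p).smulRight (tangentProj (quadric A K) p (A v))))
      (quadric A K) p := by
  -- The factor multiplying `normalCoeff A w` is only needed to be differentiable, since
  -- `normalCoeff A w p = 0`.
  let G : EuclideanSpace ℝ (Fin n) → EuclideanSpace ℝ (Fin n) := fun q =>
    K.starProjection (A (K.starProjection v - normalCoeff A v q • A q)) -
      normalCoeff A (A (K.starProjection v - normalCoeff A v q • A q)) q • A q
  have hG : ∀ q ∈ quadric A K,
      tangentProj (quadric A K) q (A (tangentExt (quadric A K) v q)) = G q := by
    intro q hq
    rw [tangentProj_quadric h hq, tangentExt, tangentProj_quadric h hq]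
  have hGp : G p = tangentProj (quadric A K) p (A v) := by
    rw [← hG p hp, tangentExt, tangentProj_eq_self hv]
  have hGd : DifferentiableAt ℝ G p := by
    have hc := differentiableAt_normalCoeff (apply_ne_zero_of_mem_quadric hp) v
    have hY : DifferentiableAt ℝ
        (fun q => A (K.starProjection v - normalCoeff A v q • A q)) p := by fun_prop
    have hc2 : DifferentiableAt ℝ
        (fun q => normalCoeff A (A (K.starProjection v - normalCoeff A v q • A q)) q) p :=
      differentiableAt_normalCoeff_comp (apply_ne_zero_of_mem_quadric hp) hY
    fun_prop
  have h1 := ((differentiableAt_normalCoeff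
    (apply_ne_zero_of_mem_quadric hp) w).hasFDerivAt.smul hGd.hasFDerivAt).neg
  rw [normalCoeff_eq_zero h hp hw, zero_smul, zero_add, hGp] at h1
  refine h1.hasFDerivWithinAt.congr (fun q hq => ?_) ?_
  · rw [leviCivita_tangentExt h hq, hG q hq]; rfl
  · rw [leviCivita_tangentExt h hp, hG p hp]; rfl

/-- The Gauss equation for a quadric, with shape operator `P A / |A p|`. -/
lemma riemann_quadric (h : IsEllipsoidal A K) (hp : p ∈ quadric A K)
    {u v w : EuclideanSpace ℝ (Fin n)} (hu : u ∈ tangentSpace (quadric A K) p)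
    (hv : v ∈ tangentSpace (quadric A K) p) (hw : w ∈ tangentSpace (quadric A K) p) :
    riemann (quadric A K) p u v w = (inner ℝ (A p) (A p))⁻¹ •
      (inner ℝ w (A v) • tangentProj (quadric A K) p (A u) -
        inner ℝ w (A u) • tangentProj (quadric A K) p (A v)) := by
  have hne := apply_ne_zero_of_mem_quadric hp
  have hw0 := ((mem_tangentSpace_quadric h hp).1 hw).2
  have second {x y : EuclideanSpace ℝ (Fin n)} (hx : x ∈ tangentSpace (quadric A K) p)
      (hy : y ∈ tangentSpace (quadric A K) p) :
      leviCivita (quadric A K) (tangentExt (quadric A K) x)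
        (leviCivita (quadric A K) (tangentExt (quadric A K) y) (tangentExt (quadric A K) w)) p =
      -((inner ℝ w (A x) * (inner ℝ (A p) (A p))⁻¹) •
        tangentProj (quadric A K) p (A y)) := by
    rw [leviCivita, tangentExt, tangentProj_eq_self hx,
      fderivWithin_eq_on_tangentSpace (hasFDerivWithinAt_leviCivita_tangentExt h hp hy hw) hx]
    simp only [neg_apply, ContinuousLinearMap.smulRight_apply, map_neg,
      map_smul, fderiv_normalCoeff hne hw0]
    rw [tangentProj_eq_self (tangentProj_mem _ _ _)]
  -- The Lie bracket of the extensions vanishes at `p`.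
  have bracket : VectorField.lieBracketWithin ℝ (tangentExt (quadric A K) u)
      (tangentExt (quadric A K) v) (quadric A K) p = 0 := by
    have hu0 := ((mem_tangentSpace_quadric h hp).1 hu).2
    have hv0 := ((mem_tangentSpace_quadric h hp).1 hv).2
    have e1 : tangentExt (quadric A K) u p = u := tangentProj_eq_self hu
    have e2 : tangentExt (quadric A K) v p = v := tangentProj_eq_self hv
    rw [VectorField.lieBracketWithin, e1, e2, fderivWithin_tangentExt h hp v hu,
      fderivWithin_tangentExt h hp u hv, normalCoeff_eq_zero h hp hu,
      normalCoeff_eq_zero h hp hv, fderiv_normalCoeff hne hu0, fderiv_normalCoeff hne hv0,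
      ← h.symm, real_inner_comm]
    simp
  have third : leviCivita (quadric A K) (VectorField.lieBracketWithin ℝ
      (tangentExt (quadric A K) u) (tangentExt (quadric A K) v) (quadric A K))
      (tangentExt (quadric A K) w) p = 0 := by
    rw [leviCivita, bracket, map_zero, map_zero]
  rw [riemann, second hu hv, second hv hu, third]
  module

/-! ### Ricci curvature, second fundamental form and Laplacian of quadrics -/

/-- The trace of `A` over the tangent space of `M` at `p`. -/
def tangentTrace (A : EuclideanSpace ℝ (Fin n) →L[ℝ] EuclideanSpace ℝ (Fin n))
    (M : Set (EuclideanSpace ℝ (Fin n))) (p : EuclideanSpace ℝ (Fin n)) : ℝ :=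
  ∑ i, inner ℝ (A (tangentBasis M p i)) (tangentBasis M p i : EuclideanSpace ℝ (Fin n))

lemma tangentProj_eq_sum (M : Set (EuclideanSpace ℝ (Fin n))) (p x : EuclideanSpace ℝ (Fin n)) :
    tangentProj M p x =
      ∑ i, inner ℝ (tangentBasis M p i : EuclideanSpace ℝ (Fin n)) x •
        (tangentBasis M p i : EuclideanSpace ℝ (Fin n)) := by
  have h := (tangentBasis M p).sum_repr' ((tangentSpace M p).orthogonalProjectionOnto x)
  rw [tangentProj, Submodule.starProjection_apply, ← congrArg Subtype.val h]
  simp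

lemma tangentTrace_eq_sum (M : Set (EuclideanSpace ℝ (Fin n))) (p : EuclideanSpace ℝ (Fin n))
    (b : OrthonormalBasis (Fin n) ℝ (EuclideanSpace ℝ (Fin n))) :
    tangentTrace A M p = ∑ j, inner ℝ (A (tangentProj M p (b j))) (b j) := by
  simp only [tangentProj_eq_sum, map_sum, map_smul, sum_inner, inner_smul_left, conj_trivial]
  rw [Finset.sum_comm]
  refine Finset.sum_congr rfl fun i _ => ?_
  rw [← b.sum_inner_mul_inner]
  refine Finset.sum_congr rfl fun j _ => ?_
  rw [mul_comm, real_inner_comm (tangentBasis M p i : EuclideanSpace ℝ (Fin n)) (b j)]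

lemma sum_inner_sq_tangentBasis (M : Set (EuclideanSpace ℝ (Fin n)))
    (p x : EuclideanSpace ℝ (Fin n)) :
    ∑ i, inner ℝ x (tangentBasis M p i : EuclideanSpace ℝ (Fin n)) ^ 2 =
      ‖tangentProj M p x‖ ^ 2 := by
  rw [← real_inner_self_eq_norm_sq, inner_tangentProj_left M (tangentProj_mem M p x),
    tangentProj_eq_sum, inner_sum]
  refine Finset.sum_congr rfl fun i _ => ?_
  rw [inner_smul_right, real_inner_comm, sq]

lemma ricci_quadric (h : IsEllipsoidal A K) (hp : p ∈ quadric A K)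
    {v : EuclideanSpace ℝ (Fin n)} (hv : v ∈ tangentSpace (quadric A K) p) :
    ricci (quadric A K) p v v = (inner ℝ (A p) (A p))⁻¹ *
      (inner ℝ v (A v) * tangentTrace A (quadric A K) p -
        ‖tangentProj (quadric A K) p (A v)‖ ^ 2) := by
  rw [ricci, ← sum_inner_sq_tangentBasis, tangentTrace, Finset.mul_sum, ← Finset.sum_sub_distrib,
    Finset.mul_sum]
  refine Finset.sum_congr rfl fun i _ => ?_
  have hi := (tangentBasis (quadric A K) p i).2
  rw [riemann_quadric h hp hi hv hv, inner_smul_left, inner_sub_left, inner_smul_left,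
    inner_smul_left, inner_tangentProj_left _ hi, inner_tangentProj_left _ hi,
    ← h.symm v (tangentBasis _ p i)]
  simp only [conj_trivial]
  ring

/-- The section of a quadric by an invariant subspace is totally geodesic: both have the normal
direction `A p`, and derivatives of tangent fields of the section are, up to tangent terms,
multiples of it. -/
lemma normSqSecondFundamentalForm_quadric {K' : Submodule ℝ (EuclideanSpace ℝ (Fin n))}
    (h : IsEllipsoidal A K) (h' : IsEllipsoidal A K') (hp : p ∈ quadric A K)
    (hp' : p ∈ quadric A K') :
    normSqSecondFundamentalForm (quadric A K) (quadric A K') p = 0 := by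
  refine Finset.sum_eq_zero fun i _ => Finset.sum_eq_zero fun j _ => ?_
  have hi := (tangentBasis (quadric A K') p i).2
  have hj := (tangentBasis (quadric A K') p j).2
  rw [secondFundamentalForm, fderivWithin_tangentExt h' hp' _ hi, normalCoeff_eq_zero h' hp' hj]
  simp [tangentProj_normal h hp, tangentProj_normal h' hp']

lemma grad_comp_inner {M : Set (EuclideanSpace ℝ (Fin n))} (e : EuclideanSpace ℝ (Fin n))
    {F F' : ℝ → ℝ} (hF : ∀ x, HasDerivAt F (F' x) x) {f : EuclideanSpace ℝ (Fin n) → ℝ}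
    (hf : ∀ q ∈ M, f q = F (inner ℝ e q)) (hp : p ∈ M) :
    grad M f p = F' (inner ℝ e p) • tangentProj M p e := by
  have h1 : HasFDerivAt (fun q => inner ℝ e q) (innerSL ℝ e) p := (innerSL ℝ e).hasFDerivAt
  have h2 := ((hF _).comp_hasFDerivAt p h1).hasFDerivWithinAt (s := M)
  have h3 : HasFDerivWithinAt f _ M p := h2.congr hf (hf p hp)
  refine ext_inner_right ℝ fun v => ?_
  rw [grad, tangentProj, Submodule.inner_starProjection_left_eq_right, gradientWithin,
    InnerProductSpace.toDual_symm_apply,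
    fderivWithin_eq_on_tangentSpace h3 (Submodule.starProjection_apply_mem _ _),
    inner_smul_left, Submodule.inner_starProjection_left_eq_right]
  simp

/-- The Laplacian of a function of the linear coordinate `⟨e, ·⟩`. -/
lemma laplacian_quadric_comp_inner (h : IsEllipsoidal A K) (hp : p ∈ quadric A K)
    (e : EuclideanSpace ℝ (Fin n)) {F F' F'' : ℝ → ℝ} (hF : ∀ x, HasDerivAt F (F' x) x)
    (hF' : ∀ x, HasDerivAt F' (F'' x) x) {f : EuclideanSpace ℝ (Fin n) → ℝ}
    (hf : ∀ q ∈ quadric A K, f q = F (inner ℝ e q)) :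
    laplacian (quadric A K) f p =
      F'' (inner ℝ e p) * ‖tangentProj (quadric A K) p e‖ ^ 2 -
        F' (inner ℝ e p) * normalCoeff A e p * tangentTrace A (quadric A K) p := by
  have h1 : HasFDerivAt (fun q => inner ℝ e q) (innerSL ℝ e) p := (innerSL ℝ e).hasFDerivAt
  have h2 := ((hF' _).comp_hasFDerivAt p h1).hasFDerivWithinAt (s := quadric A K)
  have h3 := (h2.smul (hasFDerivWithinAt_tangentExt h hp e)).congr
    (fun q hq => grad_comp_inner e hF hf hq) (grad_comp_inner e hF hf hp)
  rw [laplacian, ← sum_inner_sq_tangentBasis, tangentTrace, Finset.mul_sum, Finset.mul_sum,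
    ← Finset.sum_sub_distrib]
  refine Finset.sum_congr rfl fun i _ => ?_
  have hi := (tangentBasis (quadric A K) p i).2
  have hi0 := ((mem_tangentSpace_quadric h hp).1 hi).2
  rw [real_inner_comm] at hi0
  rw [leviCivita, tangentExt, tangentProj_eq_self hi, fderivWithin_eq_on_tangentSpace h3 hi,
    inner_tangentProj_left _ hi]
  simp only [add_apply, smul_apply,
    ContinuousLinearMap.smulRight_apply, neg_apply, inner_add_left,
    inner_smul_left, inner_neg_left, conj_trivial, hi0, innerSL_apply_apply, smul_eq_mul,
    tangentExt, Function.comp_apply, inner_tangentProj_left _ hi]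
  ring

end SubmanifoldGeometry

/-! ### Flat bump functions in one variable -/

lemma hasDerivAt_expNegInvGlue (x : ℝ) :
    HasDerivAt expNegInvGlue (x⁻¹ ^ 2 * expNegInvGlue x) x := by
  simpa using expNegInvGlue.hasDerivAt_polynomial_eval_inv_mul 1 x

lemma hasDerivAt_inv_sq_mul_expNegInvGlue (x : ℝ) :
    HasDerivAt (fun x => x⁻¹ ^ 2 * expNegInvGlue x)
      ((x⁻¹ ^ 4 - 2 * x⁻¹ ^ 3) * expNegInvGlue x) x := by
  have h := expNegInvGlue.hasDerivAt_polynomial_eval_inv_mul (Polynomial.X ^ 2) x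
  simp only [Polynomial.eval_pow, Polynomial.eval_X] at h
  refine h.congr_deriv ?_
  simp only [Polynomial.derivative_X_pow, Polynomial.eval_mul, Polynomial.eval_sub,
    Polynomial.eval_pow, Polynomial.eval_X, Polynomial.eval_C]
  push_cast
  ring

lemma continuous_inv_sq_mul_expNegInvGlue :
    Continuous (fun x : ℝ => x⁻¹ ^ 2 * expNegInvGlue x) :=
  continuous_iff_continuousAt.2 fun x => (hasDerivAt_inv_sq_mul_expNegInvGlue x).continuousAt

lemma continuous_inv_quartic_mul_expNegInvGlue :
    Continuous (fun x : ℝ => (x⁻¹ ^ 4 - 2 * x⁻¹ ^ 3) * expNegInvGlue x) := by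
  have h := expNegInvGlue.continuous_polynomial_eval_inv_mul
    (Polynomial.X ^ 4 - Polynomial.C 2 * Polynomial.X ^ 3)
  simp only [Polynomial.eval_sub, Polynomial.eval_mul, Polynomial.eval_pow, Polynomial.eval_X,
    Polynomial.eval_C] at h
  exact h

/-- Three polynomials whose sets of positivity `(1/4, ∞)`, `(-∞, -1/4)`, `(-1/4, 1/4)` are
disjoint. -/
def gluePoly : Fin 3 → ℝ → ℝ :=
  ![fun s => s - 1 / 4, fun s => -s - 1 / 4, fun s => 1 / 16 - s ^ 2]

/-- The first derivative of `gluePoly`. -/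
def gluePolyDeriv : Fin 3 → ℝ → ℝ := ![fun _ => 1, fun _ => -1, fun s => -2 * s]

/-- The (constant) second derivative of `gluePoly`. -/
def gluePolyDerivTwo : Fin 3 → ℝ := ![0, 0, -2]

lemma gluePoly_zero (s : ℝ) : gluePoly 0 s = s - 1 / 4 := rfl
lemma gluePoly_one (s : ℝ) : gluePoly 1 s = -s - 1 / 4 := rfl
lemma gluePoly_two (s : ℝ) : gluePoly 2 s = 1 / 16 - s ^ 2 := rfl
lemma gluePolyDeriv_zero (s : ℝ) : gluePolyDeriv 0 s = 1 := rfl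
lemma gluePolyDeriv_one (s : ℝ) : gluePolyDeriv 1 s = -1 := rfl
lemma gluePolyDeriv_two (s : ℝ) : gluePolyDeriv 2 s = -2 * s := rfl
lemma gluePolyDerivTwo_zero : gluePolyDerivTwo 0 = 0 := rfl
lemma gluePolyDerivTwo_one : gluePolyDerivTwo 1 = 0 := rfl
lemma gluePolyDerivTwo_two : gluePolyDerivTwo 2 = -2 := rfl

lemma hasDerivAt_gluePoly (i : Fin 3) (s : ℝ) :
    HasDerivAt (gluePoly i) (gluePolyDeriv i s) s :=
  match i with
  | 0 => (hasDerivAt_id s).sub_const _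
  | 1 => (hasDerivAt_id s).neg.sub_const _
  | 2 => (((hasDerivAt_id s).pow 2).const_sub _).congr_deriv (by simp [gluePolyDeriv_two])

lemma hasDerivAt_gluePolyDeriv (i : Fin 3) (s : ℝ) :
    HasDerivAt (gluePolyDeriv i) (gluePolyDerivTwo i) s :=
  match i with
  | 0 => hasDerivAt_const s _
  | 1 => hasDerivAt_const s _
  | 2 => ((hasDerivAt_id s).const_mul (-2)).congr_deriv (by simp [gluePolyDerivTwo_two])

lemma contDiff_gluePoly (i : Fin 3) : ContDiff ℝ ∞ (gluePoly i) :=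
  match i with
  | 0 => contDiff_id.sub contDiff_const
  | 1 => contDiff_id.neg.sub contDiff_const
  | 2 => contDiff_const.sub (contDiff_id.pow 2)

lemma continuous_gluePolyDeriv (i : Fin 3) : Continuous (gluePolyDeriv i) :=
  continuous_iff_continuousAt.2 fun s => (hasDerivAt_gluePolyDeriv i s).continuousAt

lemma eq_of_gluePoly_pos {i j : Fin 3} {s : ℝ} (hi : 0 < gluePoly i s) (hj : 0 < gluePoly j s) :
    i = j := by
  match i, j with
  | 0, 0 => rfl
  | 1, 1 => rfl
  | 2, 2 => rfl
  | 0, 1 => rw [gluePoly_zero] at hi; rw [gluePoly_one] at hj; linarith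
  | 1, 0 => rw [gluePoly_one] at hi; rw [gluePoly_zero] at hj; linarith
  | 0, 2 => rw [gluePoly_zero] at hi; rw [gluePoly_two] at hj; nlinarith
  | 2, 0 => rw [gluePoly_two] at hi; rw [gluePoly_zero] at hj; nlinarith
  | 1, 2 => rw [gluePoly_one] at hi; rw [gluePoly_two] at hj; nlinarith
  | 2, 1 => rw [gluePoly_two] at hi; rw [gluePoly_one] at hj; nlinarith

/-- The flat bump `s ↦ exp (-1 / h(s))`, with `h = gluePoly i`, extended by zero. -/
def bump (i : Fin 3) (s : ℝ) : ℝ := expNegInvGlue (gluePoly i s)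

/-- The logarithmic derivative of `bump i`. -/
def bumpLogDeriv (i : Fin 3) (s : ℝ) : ℝ := gluePolyDeriv i s * (gluePoly i s)⁻¹ ^ 2

/-- The ratio of the second derivative of `bump i` to `bump i`. -/
def bumpLogDerivTwo (i : Fin 3) (s : ℝ) : ℝ :=
  gluePolyDeriv i s ^ 2 * ((gluePoly i s)⁻¹ ^ 4 - 2 * (gluePoly i s)⁻¹ ^ 3) +
    gluePolyDerivTwo i * (gluePoly i s)⁻¹ ^ 2

lemma hasDerivAt_bump (i : Fin 3) (s : ℝ) :
    HasDerivAt (bump i) (bumpLogDeriv i s * bump i s) s := by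
  refine ((hasDerivAt_expNegInvGlue _).comp s (hasDerivAt_gluePoly i s)).congr_deriv ?_
  rw [bumpLogDeriv, bump]
  ring

lemma hasDerivAt_bumpLogDeriv_mul_bump (i : Fin 3) (s : ℝ) :
    HasDerivAt (fun s => bumpLogDeriv i s * bump i s) (bumpLogDerivTwo i s * bump i s) s := by
  have h := (hasDerivAt_gluePolyDeriv i s).mul
    ((hasDerivAt_inv_sq_mul_expNegInvGlue _).comp s (hasDerivAt_gluePoly i s))
  have e : (fun s => bumpLogDeriv i s * bump i s) =
      gluePolyDeriv i * (fun x => x⁻¹ ^ 2 * expNegInvGlue x) ∘ gluePoly i := by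
    ext x
    simp only [bumpLogDeriv, bump, Pi.mul_apply, Function.comp_apply]
    ring
  rw [e]
  refine h.congr_deriv ?_
  simp only [bumpLogDerivTwo, bump, Function.comp_apply]
  ring

lemma contDiff_bump (i : Fin 3) : ContDiff ℝ ∞ (bump i) :=
  expNegInvGlue.contDiff.comp (contDiff_gluePoly i)

lemma continuous_bumpLogDerivTwo_mul_bump (i : Fin 3) :
    Continuous (fun s => bumpLogDerivTwo i s * bump i s) := by
  have h : (fun s => bumpLogDerivTwo i s * bump i s) = fun s =>
      gluePolyDeriv i s ^ 2 * (((gluePoly i s)⁻¹ ^ 4 - 2 * (gluePoly i s)⁻¹ ^ 3) *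
        expNegInvGlue (gluePoly i s)) +
      gluePolyDerivTwo i * ((gluePoly i s)⁻¹ ^ 2 * expNegInvGlue (gluePoly i s)) := by
    ext s
    rw [bumpLogDerivTwo, bump]
    ring
  rw [h]
  have hc := (contDiff_gluePoly i).continuous
  exact (((continuous_gluePolyDeriv i).pow 2).mul
    (continuous_inv_quartic_mul_expNegInvGlue.comp hc)).add
    (continuous_const.mul (continuous_inv_sq_mul_expNegInvGlue.comp hc))

lemma bump_nonneg (i : Fin 3) (s : ℝ) : 0 ≤ bump i s := expNegInvGlue.nonneg _

lemma bump_pos_iff {i : Fin 3} {s : ℝ} : 0 < bump i s ↔ 0 < gluePoly i s := by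
  refine ⟨fun h => ?_, expNegInvGlue.pos_of_pos⟩
  by_contra h0
  exact h.ne' (expNegInvGlue.zero_of_nonpos (not_lt.1 h0))

lemma bump_mul_bump {i j : Fin 3} (hij : i ≠ j) (s : ℝ) : bump i s * bump j s = 0 := by
  by_contra h
  have hi := (bump_nonneg i s).lt_of_ne' (left_ne_zero_of_mul h)
  have hj := (bump_nonneg j s).lt_of_ne' (right_ne_zero_of_mul h)
  exact hij (eq_of_gluePoly_pos (bump_pos_iff.1 hi) (bump_pos_iff.1 hj))

/-! ### Differential inequalities for the bumps -/

/-- For the half-line bump `exp (-1 / t)` with `t = s - 1/4`: near the edge of the support the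
second derivative dominates, away from it the zeroth order term does. -/
lemma exists_halfline_bound {C θ₀ : ℝ} (hC : 0 ≤ C) (hθ₀ : 0 < θ₀) :
    ∃ R : ℝ, 0 ≤ R ∧ ∀ k, R ≤ k → ∀ θ s : ℝ, 0 ≤ θ → θ ≤ C → (s ^ 2 ≤ 1 / 4 → θ₀ ≤ θ) → s ≤ 1 →
      0 < s - 1 / 4 →
      -((1 - 2 * (s - 1 / 4)) * θ) + s * (s - 1 / 4) ^ 2 - k * (s - 1 / 4) ^ 4 < 0 := by
  obtain ⟨τ, hτ0, hτ1, hτ2⟩ : ∃ τ : ℝ, 0 < τ ∧ τ ≤ 1 / 4 ∧ τ ≤ θ₀ :=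
    ⟨min (1 / 4) θ₀, by positivity, min_le_left _ _, min_le_right _ _⟩
  refine ⟨(C + 2) / τ ^ 4, by positivity, fun k hk θ s hθ hθC hθs hs ht => ?_⟩
  have hk' : C + 2 ≤ k * τ ^ 4 := (div_le_iff₀ (by positivity)).1 hk
  have hk0 : 0 ≤ k := le_trans (by positivity) hk
  obtain ⟨t, rfl⟩ : ∃ t, s = t + 1 / 4 := ⟨s - 1 / 4, by ring⟩
  simp only [add_sub_cancel_right] at ht ⊢
  rcases le_total t τ with h | h
  · have h1 : θ₀ ≤ θ := hθs (by nlinarith)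
    have h2 : 0 ≤ k * t ^ 4 := by positivity
    have h3 : (1 - 2 * t) * θ ≥ 1 / 2 * θ := by
      apply mul_le_mul_of_nonneg_right _ hθ
      linarith
    have h4 : (t + 1 / 4) * t ^ 2 ≤ 1 / 2 * (1 / 4 * t) := by
      have : t ^ 2 ≤ 1 / 4 * t := by nlinarith
      have h5 : t + 1 / 4 ≤ 1 / 2 := by linarith
      exact mul_le_mul h5 this (by positivity) (by norm_num)
    nlinarith
  · have h1 : k * τ ^ 4 ≤ k * t ^ 4 := by gcongr
    have h2 : -((1 - 2 * t) * θ) ≤ C := by nlinarith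
    have h3 : (t + 1 / 4) * t ^ 2 ≤ 1 := by
      have : t ^ 2 ≤ 1 := by nlinarith
      nlinarith
    linarith

/-- The bumps are strict subsolutions of `-θ f'' + s f' - k f` once `k` is large, uniformly in
`θ ≤ C` bounded below for `|s| ≤ 1/2`; the common factor `bump i s / (gluePoly i s) ^ 4` has been
removed. At the edges `s = ±1/4` of the supports the second order term decides the sign. -/
lemma exists_gluePoly_bound {C θ₀ : ℝ} (hC : 0 ≤ C) (hθ₀ : 0 < θ₀) :
    ∃ R : ℝ, 0 ≤ R ∧ ∀ k, R ≤ k → ∀ (i : Fin 3) (θ s : ℝ), 0 ≤ θ → θ ≤ C →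
      (s ^ 2 ≤ 1 / 4 → θ₀ ≤ θ) → s ^ 2 ≤ 1 → 0 < gluePoly i s →
      -((gluePolyDeriv i s ^ 2 * (1 - 2 * gluePoly i s) +
          gluePolyDerivTwo i * gluePoly i s ^ 2) * θ) +
        s * gluePolyDeriv i s * gluePoly i s ^ 2 - k * gluePoly i s ^ 4 < 0 := by
  obtain ⟨R, hR0, hR⟩ := exists_halfline_bound hC hθ₀
  refine ⟨max R (32 ^ 4 * (C + 1)), le_max_of_le_left hR0, fun k hk i θ s hθ hθC hθs hs hpos => ?_⟩
  have hs1 : s ≤ 1 := by nlinarith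
  have hs2 : -s ≤ 1 := by nlinarith
  have hkR := (le_max_left _ _).trans hk
  have hkC := (le_max_right _ _).trans hk
  match i with
  | 0 =>
    have := hR k hkR θ s hθ hθC hθs hs1 hpos
    rw [gluePoly_zero, gluePolyDeriv_zero, gluePolyDerivTwo_zero]
    linarith
  | 1 =>
    have := hR k hkR θ (-s) hθ hθC (by simpa using hθs) hs2 hpos
    rw [gluePoly_one, gluePolyDeriv_one, gluePolyDerivTwo_one]
    linarith
  | 2 =>
    rw [gluePoly_two] at hpos
    rw [gluePoly_two, gluePolyDeriv_two, gluePolyDerivTwo_two]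
    obtain ⟨u, hu⟩ : ∃ u, u = 1 / 16 - s ^ 2 := ⟨_, rfl⟩
    have hk0 : 0 ≤ k := hR0.trans hkR
    have hsu : s ^ 2 = 1 / 16 - u := by linarith
    have hu1 : u ≤ 1 / 16 := by nlinarith [sq_nonneg s]
    rw [← hu] at hpos ⊢
    have h4 : 0 ≤ k * u ^ 4 := by positivity
    have h5 : 0 ≤ s ^ 2 * u ^ 2 := by positivity
    have hθ1 := hθs (by linarith)
    have e : -(((-2 * s) ^ 2 * (1 - 2 * u) + -2 * u ^ 2) * θ) + s * (-2 * s) * u ^ 2 - k * u ^ 4 =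
      -((4 * (1 / 16 - u) * (1 - 2 * u) - 2 * u ^ 2) * θ) - 2 * (s ^ 2 * u ^ 2) - k * u ^ 4 := by
      rw [← hsu]; ring
    rw [e]
    -- For `u ≤ 1/32` the bump is convex at `s`; for `u ≥ 1/32` the zeroth order term wins.
    rcases le_total u (1 / 32) with h | h
    · have h6 : 0 < 4 * (1 / 16 - u) * (1 - 2 * u) - 2 * u ^ 2 := by nlinarith
      have := mul_pos h6 (hθ₀.trans_le hθ1)
      linarith
    · have h7 : k * (1 / 32) ^ 4 ≤ k * u ^ 4 := by gcongr
      have h8 : -(4 * (1 / 16 - u) * (1 - 2 * u) - 2 * u ^ 2) ≤ 1 := by nlinarith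
      have h9 : -(4 * (1 / 16 - u) * (1 - 2 * u) - 2 * u ^ 2) * θ ≤ 1 * C := by
        rcases le_total 0 (-(4 * (1 / 16 - u) * (1 - 2 * u) - 2 * u ^ 2)) with h0 | h0
        · exact mul_le_mul h8 hθC hθ zero_le_one
        · nlinarith
      linarith

/-! ### Area of the planar section -/

lemma LipschitzOnWith.euclideanHausdorffMeasure_image_le {X Y : Type*} [EMetricSpace X]
    [EMetricSpace Y] [MeasurableSpace X] [BorelSpace X] [MeasurableSpace Y] [BorelSpace Y]
    {κ : NNReal} {f : X → Y} {s : Set X} (hf : LipschitzOnWith κ f s) (m : ℕ) :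
    μHE[m] (f '' s) ≤ (κ : ENNReal) ^ m * μHE[m] s := by
  have h := hf.hausdorffMeasure_image_le (d := (m : ℝ)) (by positivity)
  rw [Measure.euclideanHausdorffMeasure_def, Measure.euclideanHausdorffMeasure_def,
    Measure.smul_apply, Measure.smul_apply, ENNReal.smul_def, ENNReal.smul_def, smul_eq_mul,
    smul_eq_mul, mul_left_comm]
  rw [ENNReal.rpow_natCast] at h
  gcongr

lemma mem_planarSphereTwo_iff {a b c d : ℝ} {p : EuclideanSpace ℝ (Fin 4)} :
    p ∈ planarSphereTwo a b c d ↔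
      p 1 = 0 ∧ p 0 ^ 2 / a ^ 2 + p 2 ^ 2 / c ^ 2 + p 3 ^ 2 / d ^ 2 = 1 := by
  simp only [planarSphereTwo, ellipsoid, Set.mem_inter_iff, Set.mem_ofPred_eq]
  refine ⟨fun ⟨h, h1⟩ => ⟨h1, by simpa [h1] using h⟩, fun ⟨h1, h⟩ => ⟨by simpa [h1] using h, h1⟩⟩

/-- Spherical coordinates on `planarSphereTwo a b c d`. -/
def sphericalParam (a c d : ℝ) (u : EuclideanSpace ℝ (Fin 2)) : EuclideanSpace ℝ (Fin 4) :=
  !₂[a * Real.cos (u 0), 0, c * (Real.sin (u 0) * Real.cos (u 1)),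
    d * (Real.sin (u 0) * Real.sin (u 1))]

lemma contDiff_sphericalParam (a c d : ℝ) : ContDiff ℝ 1 (sphericalParam a c d) := by
  rw [contDiff_euclidean]
  intro i
  fin_cases i <;> simp [sphericalParam] <;> fun_prop

lemma planarSphereTwo_subset_image {a b c d : ℝ} (ha : 0 < a) (hc : 0 < c) (hd : 0 < d) :
    planarSphereTwo a b c d ⊆ sphericalParam a c d '' Metric.closedBall 0 10 := by
  intro p hp
  obtain ⟨h1, h⟩ := mem_planarSphereTwo_iff.1 hp
  set z : ℂ := ⟨p 2 / c, p 3 / d⟩ with hz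
  have h0 : (p 0 / a) ^ 2 + ‖z‖ ^ 2 = 1 := by
    rw [Complex.sq_norm, Complex.normSq_apply, ← h]
    simp only [hz]
    ring
  have hs1 : -1 ≤ p 0 / a := by nlinarith [norm_nonneg z]
  have hs2 : p 0 / a ≤ 1 := by nlinarith [norm_nonneg z]
  have hsin : Real.sin (Real.arccos (p 0 / a)) = ‖z‖ := by
    rw [Real.sin_arccos, ← Real.sqrt_sq (norm_nonneg z)]
    congr 1
    linarith
  refine ⟨!₂[Real.arccos (p 0 / a), z.arg], ?_, ?_⟩
  · rw [mem_closedBall_zero_iff, EuclideanSpace.norm_eq, Fin.sum_univ_two]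
    apply Real.sqrt_le_iff.2 ⟨by norm_num, ?_⟩
    have hπ := Real.pi_lt_four
    have h3 := Real.arccos_nonneg (p 0 / a)
    have h4 := Real.arccos_le_pi (p 0 / a)
    have h5 := Complex.neg_pi_lt_arg z
    have h6 := Complex.arg_le_pi z
    simp only [Real.norm_eq_abs, sq_abs]
    simp
    nlinarith
  · ext i
    fin_cases i
    · simp only [sphericalParam]
      simp [Real.cos_arccos hs1 hs2]
      field_simp
    · simp [sphericalParam, h1]
    · simp only [sphericalParam]
      simp [hsin, Complex.norm_mul_cos_arg, hz]
      field_simp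
    · simp only [sphericalParam]
      simp [hsin, Complex.norm_mul_sin_arg, hz]
      field_simp

lemma euclideanHausdorffMeasure_planarSphereTwo_lt_top {a b c d : ℝ} (ha : 0 < a) (hc : 0 < c)
    (hd : 0 < d) : μHE[2] (planarSphereTwo a b c d) < ⊤ := by
  obtain ⟨κ, hκ⟩ := (contDiff_sphericalParam a c d).contDiffOn.exists_lipschitzOnWith one_ne_zero
    (convex_closedBall (0 : EuclideanSpace ℝ (Fin 2)) 10) (isCompact_closedBall _ _)
  refine (measure_mono (planarSphereTwo_subset_image ha hc hd)).trans_lt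
    ((hκ.euclideanHausdorffMeasure_image_le 2).trans_lt ?_)
  rw [EuclideanSpace.euclideanHausdorffMeasure_eq_volume]
  exact ENNReal.mul_lt_top (ENNReal.pow_lt_top ENNReal.coe_lt_top)
    (isCompact_closedBall _ _).measure_lt_top

/-- A relatively open condition on the first coordinate which is met inside the ellipsoid holds on
a set of positive area: the orthogonal projection to a coordinate plane contains an open set. -/
lemma euclideanHausdorffMeasure_planarSphereTwo_inter_pos {a b c d : ℝ} (ha : 0 < a) (hd : 0 < d)
    {g : ℝ → ℝ} (hg : Continuous g) {s₀ : ℝ} (hs₀ : s₀ ^ 2 < 1) (hgs₀ : 0 < g s₀) :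
    0 < μHE[2] (planarSphereTwo a b c d ∩ {p | 0 < g (p 0 / a)}) := by
  let π₂ : EuclideanSpace ℝ (Fin 4) → EuclideanSpace ℝ (Fin 2) := fun p => !₂[p 0, p 2]
  have hπ : LipschitzWith 1 π₂ := by
    refine LipschitzWith.of_dist_le_mul fun p q => ?_
    rw [EuclideanSpace.dist_eq, EuclideanSpace.dist_eq, NNReal.coe_one, one_mul]
    apply Real.sqrt_le_sqrt
    rw [Fin.sum_univ_two, Fin.sum_univ_four]
    simp [π₂]
    nlinarith [sq_nonneg (dist (p 1) (q 1)), sq_nonneg (dist (p 3) (q 3))]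
  let U : Set (EuclideanSpace ℝ (Fin 2)) :=
    {u | u 0 ^ 2 / a ^ 2 + u 1 ^ 2 / c ^ 2 < 1} ∩ {u | 0 < g (u 0 / a)}
  have hU : IsOpen U := by
    refine (isOpen_lt (by fun_prop) continuous_const).inter (isOpen_lt continuous_const ?_)
    exact hg.comp (by fun_prop)
  have hne : U.Nonempty := by
    refine ⟨!₂[a * s₀, 0], ?_, ?_⟩
    · simpa [mul_pow, ha.ne'] using hs₀
    · simpa [ha.ne'] using hgs₀
  have hsub : U ⊆ π₂ '' (planarSphereTwo a b c d ∩ {p | 0 < g (p 0 / a)}) := by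
    rintro u ⟨hu1, hu2⟩
    have hu1' : u 0 ^ 2 / a ^ 2 + u 1 ^ 2 / c ^ 2 < 1 := hu1
    refine ⟨!₂[u 0, 0, u 1, d * Real.sqrt (1 - u 0 ^ 2 / a ^ 2 - u 1 ^ 2 / c ^ 2)],
      ⟨mem_planarSphereTwo_iff.2 ⟨by simp, ?_⟩, by simpa using hu2⟩, ?_⟩
    · simp
      rw [mul_pow, Real.sq_sqrt (by linarith)]
      field_simp
      ring
    · ext i
      fin_cases i <;> simp [π₂]
  have h1 := (hπ.lipschitzOnWith (s := planarSphereTwo a b c d ∩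
    {p | 0 < g (p 0 / a)})).euclideanHausdorffMeasure_image_le 2
  rw [ENNReal.coe_one, one_pow, one_mul, EuclideanSpace.euclideanHausdorffMeasure_eq_volume] at h1
  exact ((hU.measure_pos volume hne).trans_le (measure_mono hsub)).trans_le h1

lemma isClosed_planarSphereTwo (a b c d : ℝ) : IsClosed (planarSphereTwo a b c d) :=
  (isClosed_eq (by fun_prop) continuous_const).inter (isClosed_eq (by fun_prop) continuous_const)

lemma isCompact_planarSphereTwo {a b c d : ℝ} (ha : 0 < a) (hc : 0 < c) (hd : 0 < d) :
    IsCompact (planarSphereTwo a b c d) :=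
  ((isCompact_closedBall _ _).image (contDiff_sphericalParam a c d).continuous).of_isClosed_subset
    (isClosed_planarSphereTwo a b c d) (planarSphereTwo_subset_image ha hc hd)

lemma integrableOn_planarSphereTwo {a b c d : ℝ} (ha : 0 < a) (hc : 0 < c) (hd : 0 < d)
    {f : EuclideanSpace ℝ (Fin 4) → ℝ} (hf : ContinuousOn f (planarSphereTwo a b c d)) :
    IntegrableOn f (planarSphereTwo a b c d) μHE[2] := by
  obtain ⟨B, hB⟩ := (isCompact_planarSphereTwo ha hc hd).exists_bound_of_continuousOn hf
  have hm := (isClosed_planarSphereTwo a b c d).measurableSet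
  exact IntegrableOn.of_bound (euclideanHausdorffMeasure_planarSphereTwo_lt_top ha hc hd)
    (hf.aestronglyMeasurable hm) B ((ae_restrict_iff' hm).2 (Filter.Eventually.of_forall hB))

/-! ### Lower bounds for the Morse index -/

namespace SubmanifoldGeometry

lemma stabilityForm_zero {n : ℕ} (M Γ : Set (EuclideanSpace ℝ (Fin n))) :
    stabilityForm M Γ 0 = 0 := by
  have h : extendByZero (0 : Γ → ℝ) = 0 := by
    ext p
    rw [extendByZero]
    by_cases hp : ∃ q : Γ, (q : EuclideanSpace ℝ (Fin n)) = p
    · obtain ⟨q, rfl⟩ := hp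
      rw [Subtype.val_injective.extend_apply]
      rfl
    · rw [Function.extend_apply' _ _ _ hp]
  simp [stabilityForm, h]

/-- Functions `φ i` whose nontrivial linear combinations all have negative energy are automatically
independent, hence bound the Morse index from below. -/
lemma le_morseIndex {n m : ℕ} {M Γ : Set (EuclideanSpace ℝ (Fin n))}
    (φ : Fin m → smoothFunctions Γ)
    (h : ∀ v : Fin m → ℝ, v ≠ 0 → stabilityForm M Γ (∑ i, v i • (φ i : Γ → ℝ)) < 0) :
    (m : ℕ∞) ≤ morseIndex M Γ := by
  have hcoe (v : Fin m → ℝ) :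
      ((∑ i, v i • φ i : smoothFunctions Γ) : Γ → ℝ) = ∑ i, v i • (φ i : Γ → ℝ) := by
    simp
  have hli : LinearIndependent ℝ φ := by
    rw [Fintype.linearIndependent_iff]
    intro v hv
    by_contra hne
    have hv0 : v ≠ 0 := fun h0 => hne fun i => congrFun h0 i
    have h1 := h v hv0
    rw [← hcoe, hv] at h1
    exact absurd (stabilityForm_zero M Γ) h1.ne
  have hfin : Module.finrank ℝ (Submodule.span ℝ (Set.range φ)) = m := by
    rw [finrank_span_eq_card hli, Fintype.card_fin]
  have hneg : ∀ ψ ∈ Submodule.span ℝ (Set.range φ), ψ ≠ 0 →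
      stabilityForm M Γ (ψ : Γ → ℝ) < 0 := by
    intro ψ hψ hψ0
    obtain ⟨v, rfl⟩ := (Submodule.mem_span_range_iff_exists_fun ℝ).1 hψ
    rw [hcoe]
    refine h v fun hv => hψ0 ?_
    simp [hv]
  rw [morseIndex]
  refine le_iSup_of_le (Submodule.span ℝ (Set.range φ)) (le_iSup_of_le ?_ (le_iSup_of_le hneg ?_))
  · exact FiniteDimensional.span_of_finite ℝ (Set.finite_range φ)
  · rw [hfin]

end SubmanifoldGeometry

open SubmanifoldGeometry

/-! ### The ellipsoid and its planar section as quadrics -/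

/-- The diagonal matrix with entries `α` acting on Euclidean space. -/
def diagOp {n : ℕ} (α : Fin n → ℝ) : EuclideanSpace ℝ (Fin n) →L[ℝ] EuclideanSpace ℝ (Fin n) :=
  Matrix.toEuclideanCLM (𝕜 := ℝ) (Matrix.diagonal α)

lemma diagOp_apply {n : ℕ} (α : Fin n → ℝ) (x : EuclideanSpace ℝ (Fin n)) (i : Fin n) :
    diagOp α x i = α i * x i := by
  simp [diagOp, Matrix.mulVec_diagonal]

lemma isEllipsoidal_diagOp {n : ℕ} {α : Fin n → ℝ} (hα : ∀ i, 0 < α i)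
    {K : Submodule ℝ (EuclideanSpace ℝ (Fin n))} (hK : ∀ x ∈ K, diagOp α x ∈ K) :
    IsEllipsoidal (diagOp α) K where
  symm x y := by
    simp only [PiLp.inner_apply, diagOp_apply, Real.inner_apply]
    exact Finset.sum_congr rfl fun i _ => by ring
  pos x hx := by
    simp only [PiLp.inner_apply, diagOp_apply, Real.inner_apply]
    obtain ⟨i, hi⟩ : ∃ i, x i ≠ 0 := by
      by_contra! h
      exact hx (by ext i; simpa using h i)
    refine Finset.sum_pos' (fun j _ => ?_) ⟨i, Finset.mem_univ i, ?_⟩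
    · have := hα j
      nlinarith [mul_nonneg this.le (sq_nonneg (x j))]
    · have := mul_pos (hα i) (sq_pos_of_ne_zero hi)
      nlinarith
  map_mem := hK

/-- The hyperplane `{x₁ = 0}` of `ℝ⁴` (coordinates numbered from `0`). -/
def coordHyperplane : Submodule ℝ (EuclideanSpace ℝ (Fin 4)) :=
  ((EuclideanSpace.proj 1 : EuclideanSpace ℝ (Fin 4) →L[ℝ] ℝ) :
    EuclideanSpace ℝ (Fin 4) →ₗ[ℝ] ℝ).ker

lemma mem_coordHyperplane {x : EuclideanSpace ℝ (Fin 4)} : x ∈ coordHyperplane ↔ x 1 = 0 :=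
  Iff.rfl

lemma starProjection_coordHyperplane (x : EuclideanSpace ℝ (Fin 4)) :
    coordHyperplane.starProjection x = x - EuclideanSpace.single 1 (x 1) := by
  refine Submodule.eq_starProjection_of_mem_of_inner_eq_zero ?_ ?_
  · simp [mem_coordHyperplane]
  · intro w hw
    rw [mem_coordHyperplane] at hw
    simp [EuclideanSpace.inner_single_left, hw]

/-- The inverse squares of the semiaxes. -/
def axisCoeff (a b c d : ℝ) : Fin 4 → ℝ := ![(a ^ 2)⁻¹, (b ^ 2)⁻¹, (c ^ 2)⁻¹, (d ^ 2)⁻¹]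

lemma ellipsoid_eq_quadric (a b c d : ℝ) :
    ellipsoid a b c d = quadric (diagOp (axisCoeff a b c d)) ⊤ := by
  ext x
  simp only [ellipsoid, quadric, Set.mem_ofPred_eq, Submodule.mem_top, true_and,
    PiLp.inner_apply, diagOp_apply, Real.inner_apply, Fin.sum_univ_four, axisCoeff]
  refine Eq.congr_left ?_
  simp
  ring

lemma planarSphereTwo_eq_quadric (a b c d : ℝ) :
    planarSphereTwo a b c d = quadric (diagOp (axisCoeff a b c d)) coordHyperplane := by
  rw [planarSphereTwo, ellipsoid_eq_quadric]
  ext x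
  simp [quadric, mem_coordHyperplane, and_comm]

/-! ### The stability operator of the planar section -/

section Curvature

variable {α : Fin 4 → ℝ} {p : EuclideanSpace ℝ (Fin 4)}

/-- The squared norm of the gradient `A p`, for `p` in the hyperplane. -/
def gradNormSq (α : Fin 4 → ℝ) (p : EuclideanSpace ℝ (Fin 4)) : ℝ :=
  α 0 ^ 2 * p 0 ^ 2 + α 2 ^ 2 * p 2 ^ 2 + α 3 ^ 2 * p 3 ^ 2

/-- The mean curvature of the planar section divided by `|A p|`. -/
def scaledMeanCurvature (α : Fin 4 → ℝ) (p : EuclideanSpace ℝ (Fin 4)) : ℝ :=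
  (α 0 + α 2 + α 3 - (α 0 ^ 3 * p 0 ^ 2 + α 2 ^ 3 * p 2 ^ 2 + α 3 ^ 3 * p 3 ^ 2) /
    gradNormSq α p) / gradNormSq α p

/-- The squared norm of the gradient of the first coordinate along the planar section. -/
def coordGradNormSq (α : Fin 4 → ℝ) (p : EuclideanSpace ℝ (Fin 4)) : ℝ :=
  1 - α 0 ^ 2 * p 0 ^ 2 / gradNormSq α p

lemma inner_diagOp_self (hp : p 1 = 0) : inner ℝ (diagOp α p) (diagOp α p) = gradNormSq α p := by
  simp only [PiLp.inner_apply, diagOp_apply, Real.inner_apply, Fin.sum_univ_four, gradNormSq, hp]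
  ring

lemma isEllipsoidal_top (hα : ∀ i, 0 < α i) : IsEllipsoidal (diagOp α) ⊤ :=
  isEllipsoidal_diagOp hα fun _ _ => Submodule.mem_top

lemma isEllipsoidal_coordHyperplane (hα : ∀ i, 0 < α i) :
    IsEllipsoidal (diagOp α) coordHyperplane :=
  isEllipsoidal_diagOp hα fun x hx => by
    rw [mem_coordHyperplane] at hx ⊢
    rw [diagOp_apply, hx, mul_zero]

lemma mem_quadric_top (hp : p ∈ quadric (diagOp α) coordHyperplane) :
    p ∈ quadric (diagOp α) ⊤ :=
  ⟨Submodule.mem_top, hp.2⟩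

lemma gradNormSq_pos (hp : p ∈ quadric (diagOp α) coordHyperplane) : 0 < gradNormSq α p := by
  rw [← inner_diagOp_self (mem_coordHyperplane.1 hp.1)]
  exact inner_apply_self_pos_of_mem_quadric hp

lemma tangentTrace_coordHyperplane (hα : ∀ i, 0 < α i)
    (hp : p ∈ quadric (diagOp α) coordHyperplane) :
    tangentTrace (diagOp α) (quadric (diagOp α) coordHyperplane) p =
      scaledMeanCurvature α p * gradNormSq α p := by
  have hp1 : p 1 = 0 := hp.1
  have hG := (gradNormSq_pos hp).ne'
  rw [tangentTrace_eq_sum _ _ (EuclideanSpace.basisFun (Fin 4) ℝ), Fin.sum_univ_four]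
  simp only [tangentProj_quadric (isEllipsoidal_coordHyperplane hα) hp,
    starProjection_coordHyperplane, normalCoeff, inner_diagOp_self hp1]
  simp [EuclideanSpace.inner_single_left, EuclideanSpace.inner_single_right, diagOp_apply, hp1]
  rw [scaledMeanCurvature]
  field_simp
  ring

lemma tangentTrace_top (hα : ∀ i, 0 < α i) (hp : p ∈ quadric (diagOp α) coordHyperplane) :
    tangentTrace (diagOp α) (quadric (diagOp α) ⊤) p =
      α 1 + scaledMeanCurvature α p * gradNormSq α p := by
  have hp1 : p 1 = 0 := hp.1
  have hG := (gradNormSq_pos hp).ne'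
  rw [tangentTrace_eq_sum _ _ (EuclideanSpace.basisFun (Fin 4) ℝ), Fin.sum_univ_four]
  simp only [tangentProj_quadric (isEllipsoidal_top hα) (mem_quadric_top hp),
    Submodule.starProjection_top', normalCoeff, inner_diagOp_self hp1]
  simp [EuclideanSpace.inner_single_left, EuclideanSpace.inner_single_right, diagOp_apply, hp1]
  rw [scaledMeanCurvature]
  field_simp
  ring

lemma norm_sq_tangentProj_single_zero (hα : ∀ i, 0 < α i)
    (hp : p ∈ quadric (diagOp α) coordHyperplane) :
    ‖tangentProj (quadric (diagOp α) coordHyperplane) p (EuclideanSpace.single 0 1)‖ ^ 2 =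
      coordGradNormSq α p := by
  have hp1 : p 1 = 0 := hp.1
  have hG := (gradNormSq_pos hp).ne'
  rw [← real_inner_self_eq_norm_sq, inner_tangentProj_left _ (tangentProj_mem _ _ _),
    tangentProj_quadric (isEllipsoidal_coordHyperplane hα) hp, starProjection_coordHyperplane,
    normalCoeff, inner_diagOp_self hp1]
  simp [EuclideanSpace.inner_single_left, diagOp_apply]
  rw [coordGradNormSq]
  field_simp

/-- A unit normal of the planar section is the coordinate vector `e₁`, up to sign. -/
lemma exists_unitNormal_eq (hα : ∀ i, 0 < α i) (hp : p ∈ quadric (diagOp α) coordHyperplane) :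
    ∃ t : ℝ, t ^ 2 = 1 ∧
      unitNormal (quadric (diagOp α) ⊤) (quadric (diagOp α) coordHyperplane) p =
        EuclideanSpace.single 1 t := by
  have hp1 : p 1 = 0 := hp.1
  have hex : ∃ ν, IsUnitNormal (quadric (diagOp α) ⊤) (quadric (diagOp α) coordHyperplane) p ν := by
    refine ⟨EuclideanSpace.single 1 1, ?_, ?_, by simp⟩
    · rw [mem_tangentSpace_quadric (isEllipsoidal_top hα) (mem_quadric_top hp)]
      simp [EuclideanSpace.inner_single_left, diagOp_apply, hp1]
    · rw [Submodule.mem_orthogonal]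
      intro u hu
      have h1 : u 1 = 0 := ((mem_tangentSpace_quadric (isEllipsoidal_coordHyperplane hα) hp).1 hu).1
      simp [EuclideanSpace.inner_single_right, h1]
  obtain ⟨h1, h2, h3⟩ : IsUnitNormal (quadric (diagOp α) ⊤)
      (quadric (diagOp α) coordHyperplane) p
      (unitNormal (quadric (diagOp α) ⊤) (quadric (diagOp α) coordHyperplane) p) := by
    rw [unitNormal, dif_pos hex]
    exact hex.choose_spec
  set ν := unitNormal (quadric (diagOp α) ⊤) (quadric (diagOp α) coordHyperplane) p
  have h4 := ((mem_tangentSpace_quadric (isEllipsoidal_top hα) (mem_quadric_top hp)).1 h1).2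
  have h5 : ν - EuclideanSpace.single 1 (ν 1) ∈
      tangentSpace (quadric (diagOp α) coordHyperplane) p := by
    refine (mem_tangentSpace_quadric (isEllipsoidal_coordHyperplane hα) hp).2 ⟨?_, ?_⟩
    · simp [mem_coordHyperplane]
    · rw [inner_sub_left, h4]
      simp [EuclideanSpace.inner_single_left, diagOp_apply, hp1]
  have h6 := (Submodule.mem_orthogonal _ _).1 h2 _ h5
  have h7 : ν = EuclideanSpace.single 1 (ν 1) := by
    rw [← sub_eq_zero, ← inner_self_eq_zero (𝕜 := ℝ), inner_sub_right, h6]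
    simp [EuclideanSpace.inner_single_right]
  refine ⟨ν 1, ?_, h7⟩
  rw [h7, PiLp.norm_single, Real.norm_eq_abs] at h3
  rw [← sq_abs, h3, one_pow]

lemma ricci_unitNormal (hα : ∀ i, 0 < α i) (hp : p ∈ quadric (diagOp α) coordHyperplane) :
    ricci (quadric (diagOp α) ⊤) p
        (unitNormal (quadric (diagOp α) ⊤) (quadric (diagOp α) coordHyperplane) p)
        (unitNormal (quadric (diagOp α) ⊤) (quadric (diagOp α) coordHyperplane) p) =
      α 1 * scaledMeanCurvature α p := by
  have hp1 : p 1 = 0 := hp.1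
  have hG := (gradNormSq_pos hp).ne'
  obtain ⟨t, ht, hν⟩ := exists_unitNormal_eq hα hp
  have hmem (r : ℝ) : EuclideanSpace.single 1 r ∈ tangentSpace (quadric (diagOp α) ⊤) p := by
    rw [mem_tangentSpace_quadric (isEllipsoidal_top hα) (mem_quadric_top hp)]
    simp [EuclideanSpace.inner_single_left, diagOp_apply, hp1]
  have hA : diagOp α (EuclideanSpace.single 1 t) = EuclideanSpace.single 1 (α 1 * t) := by
    ext i
    rw [diagOp_apply]
    by_cases hi : i = 1
    · subst hi; simp
    · simp [hi]
  rw [hν, ricci_quadric (isEllipsoidal_top hα) (mem_quadric_top hp) (hmem t), hA,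
    tangentProj_eq_self (hmem _), PiLp.norm_single, Real.norm_eq_abs, sq_abs,
    inner_diagOp_self hp1, tangentTrace_top hα hp]
  simp only [EuclideanSpace.inner_single_left, PiLp.single_apply, if_true, conj_trivial]
  have e : t * (α 1 * t) = α 1 := by linear_combination α 1 * ht
  have e2 : (α 1 * t) ^ 2 = α 1 ^ 2 := by linear_combination α 1 ^ 2 * ht
  rw [e, e2]
  field_simp
  ring

/-- The stability operator on functions of the first coordinate. Constants are eigenfunctions with
weight `scaledMeanCurvature`, with eigenvalue `-α 1`, because
`Ric(ν, ν) = α 1 · scaledMeanCurvature` and the section is totally geodesic. -/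
lemma stabilityOperator_quadric (hα : ∀ i, 0 < α i)
    (hp : p ∈ quadric (diagOp α) coordHyperplane) {F F' F'' : ℝ → ℝ}
    (hF : ∀ x, HasDerivAt F (F' x) x) (hF' : ∀ x, HasDerivAt F' (F'' x) x)
    {f : EuclideanSpace ℝ (Fin 4) → ℝ}
    (hf : ∀ q ∈ quadric (diagOp α) coordHyperplane, f q = F (q 0)) :
    stabilityOperator (quadric (diagOp α) ⊤) (quadric (diagOp α) coordHyperplane) f p =
      -(F'' (p 0) * coordGradNormSq α p) +
        α 0 * p 0 * F' (p 0) * scaledMeanCurvature α p -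
        α 1 * scaledMeanCurvature α p * F (p 0) := by
  have hp1 : p 1 = 0 := hp.1
  have hG := (gradNormSq_pos hp).ne'
  have hcoord (q : EuclideanSpace ℝ (Fin 4)) :
      inner ℝ (EuclideanSpace.single (0 : Fin 4) (1 : ℝ)) q = q 0 := by
    simp [EuclideanSpace.inner_single_left]
  have hf' : ∀ q ∈ quadric (diagOp α) coordHyperplane,
      f q = F (inner ℝ (EuclideanSpace.single (0 : Fin 4) (1 : ℝ)) q) := by
    intro q hq
    rw [hcoord, hf q hq]
  rw [stabilityOperator, laplacian_quadric_comp_inner (isEllipsoidal_coordHyperplane hα) hp _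
    hF hF' hf', normSqSecondFundamentalForm_quadric (isEllipsoidal_top hα)
    (isEllipsoidal_coordHyperplane hα) (mem_quadric_top hp) hp, ricci_unitNormal hα hp,
    norm_sq_tangentProj_single_zero hα hp, tangentTrace_coordHyperplane hα hp, hf p hp,
    normalCoeff, inner_diagOp_self hp1, hcoord, hcoord, diagOp_apply]
  field_simp
  ring

/-- Bounds on the curvature that do not involve the smallest coefficient `α 0`. -/
lemma curvature_bounds (hα0 : 0 < α 0) (h02 : α 0 ≤ α 2) (h23 : α 2 ≤ α 3)
    (hp : p ∈ quadric (diagOp α) coordHyperplane) :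
    0 < scaledMeanCurvature α p ∧ 0 ≤ coordGradNormSq α p ∧
      coordGradNormSq α p ≤ α 3 / α 2 * scaledMeanCurvature α p ∧
      (1 - α 0 * p 0 ^ 2) * (α 2 / (2 * α 3)) * scaledMeanCurvature α p ≤ coordGradNormSq α p ∧
      α 0 * p 0 ^ 2 ≤ 1 := by
  have hp1 : p 1 = 0 := hp.1
  have hG := gradNormSq_pos hp
  have h2 : 0 < α 2 := hα0.trans_le h02
  have h3 : 0 < α 3 := h2.trans_le h23
  have hq : α 0 * p 0 ^ 2 + α 2 * p 2 ^ 2 + α 3 * p 3 ^ 2 = 1 := by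
    have h := hp.2
    simp only [PiLp.inner_apply, diagOp_apply, Real.inner_apply, Fin.sum_univ_four, hp1] at h
    linear_combination h
  have hτ : scaledMeanCurvature α p = ((α 0 + α 2 + α 3) * gradNormSq α p -
      (α 0 ^ 3 * p 0 ^ 2 + α 2 ^ 3 * p 2 ^ 2 + α 3 ^ 3 * p 3 ^ 2)) / gradNormSq α p ^ 2 := by
    rw [scaledMeanCurvature]
    field_simp
  have hρ : coordGradNormSq α p =
      (α 2 ^ 2 * p 2 ^ 2 + α 3 ^ 2 * p 3 ^ 2) / gradNormSq α p := by
    rw [coordGradNormSq, eq_div_iff hG.ne', sub_mul, div_mul_cancel₀ _ hG.ne', gradNormSq]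
    ring
  rw [hτ, hρ]
  set P := α 2 ^ 2 * p 2 ^ 2 + α 3 ^ 2 * p 3 ^ 2 with hP
  set S := (α 0 + α 2 + α 3) * gradNormSq α p -
      (α 0 ^ 3 * p 0 ^ 2 + α 2 ^ 3 * p 2 ^ 2 + α 3 ^ 3 * p 3 ^ 2) with hS
  have hP0 : 0 ≤ P := by positivity
  have hx1 : 0 ≤ 1 - α 0 * p 0 ^ 2 := by
    have : 1 - α 0 * p 0 ^ 2 = α 2 * p 2 ^ 2 + α 3 * p 3 ^ 2 := by linarith
    rw [this]
    positivity
  have hSl : α 2 * gradNormSq α p ≤ S := by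
    have : S - α 2 * gradNormSq α p = α 3 * (α 0 ^ 2 * p 0 ^ 2) +
        (α 0 + (α 3 - α 2)) * (α 2 ^ 2 * p 2 ^ 2) + α 0 * (α 3 ^ 2 * p 3 ^ 2) := by
      rw [hS, gradNormSq]
      ring
    have h32 : 0 ≤ α 3 - α 2 := sub_nonneg.2 h23
    have : 0 ≤ S - α 2 * gradNormSq α p := by
      rw [this]
      positivity
    linarith
  have hSu : S ≤ 2 * α 3 * gradNormSq α p := by
    have : 2 * α 3 * gradNormSq α p - S = (α 3 - α 2) * (α 0 ^ 2 * p 0 ^ 2) +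
        (α 3 - α 0) * (α 2 ^ 2 * p 2 ^ 2) + ((α 3 - α 0) + (α 3 - α 2)) * (α 3 ^ 2 * p 3 ^ 2) := by
      rw [hS, gradNormSq]
      ring
    have h32 : 0 ≤ α 3 - α 2 := sub_nonneg.2 h23
    have h30 : 0 ≤ α 3 - α 0 := sub_nonneg.2 (h02.trans h23)
    have : 0 ≤ 2 * α 3 * gradNormSq α p - S := by
      rw [this]
      positivity
    linarith
  have hPl : (1 - α 0 * p 0 ^ 2) * α 2 ≤ P := by
    have : P - (1 - α 0 * p 0 ^ 2) * α 2 = (α 3 - α 2) * (α 3 * p 3 ^ 2) := by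
      rw [hP]
      linear_combination α 2 * hq
    have h32 : 0 ≤ α 3 - α 2 := sub_nonneg.2 h23
    have : 0 ≤ P - (1 - α 0 * p 0 ^ 2) * α 2 := by
      rw [this]
      positivity
    linarith
  have hPu : P ≤ α 3 := by
    have : α 3 - P = α 3 * (α 0 * p 0 ^ 2) + (α 3 - α 2) * (α 2 * p 2 ^ 2) := by
      rw [hP]
      linear_combination -α 3 * hq
    have h32 : 0 ≤ α 3 - α 2 := sub_nonneg.2 h23
    have : 0 ≤ α 3 - P := by
      rw [this]
      positivity
    linarith
  have hS0 : 0 < S := (mul_pos h2 hG).trans_le hSl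
  refine ⟨by positivity, by positivity, ?_, ?_, by linarith⟩
  · rw [div_mul_div_comm, div_le_div_iff₀ hG (by positivity)]
    calc P * (α 2 * gradNormSq α p ^ 2) ≤ α 3 * (α 2 * gradNormSq α p ^ 2) := by gcongr
      _ = α 3 * (α 2 * gradNormSq α p) * gradNormSq α p := by ring
      _ ≤ α 3 * S * gradNormSq α p := by gcongr
  · have e : (1 - α 0 * p 0 ^ 2) * (α 2 / (2 * α 3)) * (S / gradNormSq α p ^ 2) =
        (1 - α 0 * p 0 ^ 2) * α 2 * S / (2 * α 3 * gradNormSq α p ^ 2) := by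
      field_simp
    rw [e, div_le_div_iff₀ (by positivity) hG]
    calc (1 - α 0 * p 0 ^ 2) * α 2 * S * gradNormSq α p
        ≤ P * (2 * α 3 * gradNormSq α p) * gradNormSq α p := by gcongr
      _ = P * (2 * α 3 * gradNormSq α p ^ 2) := by ring

end Curvature

/-! ### The test functions and their energy -/

section TestFunctions

variable {a b c d : ℝ} {p : EuclideanSpace ℝ (Fin 4)}

/-- The linear combination `∑ vᵢ · bump i` of the test functions, rescaled to `[-a, a]`. -/
def testProfile (a : ℝ) (v : Fin 3 → ℝ) (x : ℝ) : ℝ := ∑ i, v i * bump i (x / a)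

/-- The first derivative of `testProfile`. -/
def testProfileDeriv (a : ℝ) (v : Fin 3 → ℝ) (x : ℝ) : ℝ :=
  ∑ i, v i * (bumpLogDeriv i (x / a) * bump i (x / a) / a)

/-- The second derivative of `testProfile`. -/
def testProfileDerivTwo (a : ℝ) (v : Fin 3 → ℝ) (x : ℝ) : ℝ :=
  ∑ i, v i * (bumpLogDerivTwo i (x / a) * bump i (x / a) / a ^ 2)

lemma hasDerivAt_testProfile (a : ℝ) (v : Fin 3 → ℝ) (x : ℝ) :
    HasDerivAt (testProfile a v) (testProfileDeriv a v x) x := by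
  refine HasDerivAt.fun_sum fun i _ => ?_
  refine (((hasDerivAt_bump i (x / a)).comp x
    ((hasDerivAt_id x).div_const a)).const_mul (v i)).congr_deriv ?_
  ring

lemma hasDerivAt_testProfileDeriv (a : ℝ) (v : Fin 3 → ℝ) (x : ℝ) :
    HasDerivAt (testProfileDeriv a v) (testProfileDerivTwo a v x) x := by
  refine HasDerivAt.fun_sum fun i _ => ?_
  refine ((((hasDerivAt_bumpLogDeriv_mul_bump i (x / a)).comp x
    ((hasDerivAt_id x).div_const a)).div_const a).const_mul (v i)).congr_deriv ?_
  ring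

lemma continuous_testProfile (a : ℝ) (v : Fin 3 → ℝ) : Continuous (testProfile a v) :=
  continuous_iff_continuousAt.2 fun x => (hasDerivAt_testProfile a v x).continuousAt

lemma continuous_testProfileDeriv (a : ℝ) (v : Fin 3 → ℝ) : Continuous (testProfileDeriv a v) :=
  continuous_iff_continuousAt.2 fun x => (hasDerivAt_testProfileDeriv a v x).continuousAt

lemma continuous_testProfileDerivTwo (a : ℝ) (v : Fin 3 → ℝ) :
    Continuous (testProfileDerivTwo a v) :=
  continuous_finsetSum _ fun i _ => continuous_const.mul
    (((continuous_bumpLogDerivTwo_mul_bump i).comp (continuous_id.div_const a)).div_const _)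

/-- The ratio `L f / f` for the test function `f = bump i (x₀ / a)`, where `L` is the stability
operator. -/
def bumpRatio (a b c d : ℝ) (i : Fin 3) (p : EuclideanSpace ℝ (Fin 4)) : ℝ :=
  -(bumpLogDerivTwo i (p 0 / a) / a ^ 2 * coordGradNormSq (axisCoeff a b c d) p) +
    (a ^ 2)⁻¹ * p 0 * (bumpLogDeriv i (p 0 / a) / a) * scaledMeanCurvature (axisCoeff a b c d) p -
    (b ^ 2)⁻¹ * scaledMeanCurvature (axisCoeff a b c d) p

/-- The density `f L f` of the stability form for the test function `f` with coefficients `v`. -/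
def energyDensity (a b c d : ℝ) (v : Fin 3 → ℝ) (p : EuclideanSpace ℝ (Fin 4)) : ℝ :=
  testProfile a v (p 0) *
    (-(testProfileDerivTwo a v (p 0) * coordGradNormSq (axisCoeff a b c d) p) +
      (a ^ 2)⁻¹ * p 0 * testProfileDeriv a v (p 0) * scaledMeanCurvature (axisCoeff a b c d) p -
      (b ^ 2)⁻¹ * scaledMeanCurvature (axisCoeff a b c d) p * testProfile a v (p 0))

/-- The stability form is diagonal, already before integration, since the bumps have disjoint
supports. -/
lemma energyDensity_eq_sum (a b c d : ℝ) (v : Fin 3 → ℝ) (p : EuclideanSpace ℝ (Fin 4)) :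
    energyDensity a b c d v p =
      ∑ i, v i ^ 2 * bump i (p 0 / a) ^ 2 * bumpRatio a b c d i p := by
  have h01 := bump_mul_bump (show (0 : Fin 3) ≠ 1 by decide) (p 0 / a)
  have h02 := bump_mul_bump (show (0 : Fin 3) ≠ 2 by decide) (p 0 / a)
  have h12 := bump_mul_bump (show (1 : Fin 3) ≠ 2 by decide) (p 0 / a)
  have e : energyDensity a b c d v p = (∑ i, v i * bump i (p 0 / a)) *
      ∑ i, v i * bump i (p 0 / a) * bumpRatio a b c d i p := by
    simp only [energyDensity, testProfile, testProfileDeriv, testProfileDerivTwo, bumpRatio,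
      Fin.sum_univ_three]
    ring
  rw [e]
  simp only [Fin.sum_univ_three]
  linear_combination v 0 * v 1 * (bumpRatio a b c d 0 p + bumpRatio a b c d 1 p) * h01 +
    v 0 * v 2 * (bumpRatio a b c d 0 p + bumpRatio a b c d 2 p) * h02 +
    v 1 * v 2 * (bumpRatio a b c d 1 p + bumpRatio a b c d 2 p) * h12

/-- For a long ellipsoid each bump is a strict subsolution on its support. -/
lemma exists_bumpRatio_neg (hd : 0 < d) (hcd : d < c) (hbc : c < b) :
    ∃ a₀ : ℝ, b < a₀ ∧ ∀ a, a₀ < a → ∀ p ∈ planarSphereTwo a b c d, ∀ i,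
      0 < bump i (p 0 / a) → bumpRatio a b c d i p < 0 := by
  have hc : 0 < c := hd.trans hcd
  have hb : 0 < b := hc.trans hbc
  obtain ⟨R, hR0, hR⟩ := exists_gluePoly_bound (C := (d ^ 2)⁻¹ / (c ^ 2)⁻¹)
    (θ₀ := 3 / 4 * ((c ^ 2)⁻¹ / (2 * (d ^ 2)⁻¹))) (by positivity) (by positivity)
  refine ⟨b * (R + 2), by nlinarith, fun a ha p hp i hi => ?_⟩
  have hab : b < a := by nlinarith
  have ha0 : 0 < a := hb.trans hab
  have hk : R ≤ a ^ 2 / b ^ 2 := by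
    rw [le_div_iff₀ (by positivity)]
    have : (b * (R + 2)) ^ 2 ≤ a ^ 2 := by gcongr
    nlinarith [sq_nonneg b, mul_nonneg hR0 (sq_nonneg b), mul_nonneg (sq_nonneg R) (sq_nonneg b)]
  rw [planarSphereTwo_eq_quadric] at hp
  obtain ⟨hτ, hρ, hu, hl, hx⟩ := curvature_bounds (α := axisCoeff a b c d)
    (by simp [axisCoeff]; positivity)
    (by simp only [axisCoeff]; simp; gcongr; linarith)
    (by simp only [axisCoeff]; simp; gcongr) hp
  have e0 : axisCoeff a b c d 0 = (a ^ 2)⁻¹ := rfl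
  have e2 : axisCoeff a b c d 2 = (c ^ 2)⁻¹ := rfl
  have e3 : axisCoeff a b c d 3 = (d ^ 2)⁻¹ := rfl
  rw [e2, e3] at hu hl
  rw [e0] at hl hx
  rw [bumpRatio]
  set τ := scaledMeanCurvature (axisCoeff a b c d) p
  set ρ := coordGradNormSq (axisCoeff a b c d) p
  obtain ⟨s, hs⟩ : ∃ s, s = p 0 / a := ⟨_, rfl⟩
  have hps : p 0 = a * s := by rw [hs]; field_simp
  have hsx : (a ^ 2)⁻¹ * p 0 ^ 2 = s ^ 2 := by rw [hps]; field_simp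
  rw [hsx] at hl hx
  rw [← hs] at hi ⊢
  have hpos := bump_pos_iff.1 hi
  -- The inequality for the bumps is applied to the ratio `ρ / τ` and the coefficient `a² / b²`.
  have key := hR (a ^ 2 / b ^ 2) hk i (ρ / τ) s (by positivity) ((div_le_iff₀ hτ).2 hu)
    (fun h => by
      rw [le_div_iff₀ hτ]
      refine le_trans ?_ hl
      gcongr
      linarith) hx hpos
  have h1 : τ / (a ^ 2 * gluePoly i s ^ 4) * (-((gluePolyDeriv i s ^ 2 * (1 - 2 * gluePoly i s) +
      gluePolyDerivTwo i * gluePoly i s ^ 2) * (ρ / τ)) +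
      s * gluePolyDeriv i s * gluePoly i s ^ 2 - a ^ 2 / b ^ 2 * gluePoly i s ^ 4) < 0 :=
    mul_neg_of_pos_of_neg (by positivity) key
  refine lt_of_eq_of_lt ?_ h1
  rw [hps, bumpLogDeriv, bumpLogDerivTwo]
  field_simp

lemma extendByZero_apply {n : ℕ} {Γ : Set (EuclideanSpace ℝ (Fin n))} (φ : Γ → ℝ)
    {q : EuclideanSpace ℝ (Fin n)} (hq : q ∈ Γ) : extendByZero φ q = φ ⟨q, hq⟩ :=
  Subtype.val_injective.extend_apply φ 0 ⟨q, hq⟩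

/-- The `i`-th test function as an element of `C^∞(Γ₂)`. -/
def testFunction (a b c d : ℝ) (i : Fin 3) : smoothFunctions (planarSphereTwo a b c d) :=
  ⟨fun q => bump i (q.1 0 / a), fun q => bump i (q 0 / a),
    (contDiff_bump i).comp (by fun_prop), fun _ => rfl⟩

lemma stabilityForm_testFunction (ha : 0 < a) (hb : 0 < b) (hc : 0 < c) (hd : 0 < d)
    (v : Fin 3 → ℝ) :
    stabilityForm (ellipsoid a b c d) (planarSphereTwo a b c d)
        (∑ i, v i • (testFunction a b c d i : planarSphereTwo a b c d → ℝ)) =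
      ∫ p in planarSphereTwo a b c d, energyDensity a b c d v p ∂μHE[2] := by
  refine setIntegral_congr_fun (isClosed_planarSphereTwo a b c d).measurableSet fun p hp => ?_
  have hα : ∀ i, 0 < axisCoeff a b c d i := by
    intro i
    fin_cases i <;> simp [axisCoeff] <;> positivity
  have hf : ∀ q ∈ planarSphereTwo a b c d,
      extendByZero (∑ i, v i • (testFunction a b c d i : planarSphereTwo a b c d → ℝ)) q =
        testProfile a v (q 0) := by
    intro q hq
    rw [extendByZero_apply _ hq, Finset.sum_apply]
    rfl
  have hfp := hf p hp
  simp only [hfp]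
  generalize extendByZero
    (∑ i, v i • (testFunction a b c d i : planarSphereTwo a b c d → ℝ)) = f at hf ⊢
  rw [planarSphereTwo_eq_quadric] at hp hf
  have h := stabilityOperator_quadric hα hp (hasDerivAt_testProfile a v)
    (hasDerivAt_testProfileDeriv a v) hf
  rw [← planarSphereTwo_eq_quadric, ← ellipsoid_eq_quadric] at h
  rw [h]
  rfl

lemma continuousOn_energyDensity (a b c d : ℝ) (v : Fin 3 → ℝ) :
    ContinuousOn (energyDensity a b c d v) (planarSphereTwo a b c d) := by
  have h0 := (continuous_testProfile a v).comp
    (show Continuous fun p : EuclideanSpace ℝ (Fin 4) => p 0 by fun_prop)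
  have h1 := (continuous_testProfileDeriv a v).comp
    (show Continuous fun p : EuclideanSpace ℝ (Fin 4) => p 0 by fun_prop)
  have h2 := (continuous_testProfileDerivTwo a v).comp
    (show Continuous fun p : EuclideanSpace ℝ (Fin 4) => p 0 by fun_prop)
  have hG : ContinuousOn (gradNormSq (axisCoeff a b c d)) (planarSphereTwo a b c d) := by
    unfold gradNormSq
    fun_prop
  have hne : ∀ p ∈ planarSphereTwo a b c d, gradNormSq (axisCoeff a b c d) p ≠ 0 := by
    intro p hp
    rw [planarSphereTwo_eq_quadric] at hp
    exact (gradNormSq_pos hp).ne'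
  have hτ : ContinuousOn (scaledMeanCurvature (axisCoeff a b c d)) (planarSphereTwo a b c d) := by
    unfold scaledMeanCurvature
    exact (continuousOn_const.sub ((by fun_prop : Continuous _).continuousOn.div hG hne)).div hG hne
  have hρ : ContinuousOn (coordGradNormSq (axisCoeff a b c d)) (planarSphereTwo a b c d) := by
    unfold coordGradNormSq
    exact continuousOn_const.sub ((by fun_prop : Continuous _).continuousOn.div hG hne)
  have hx : Continuous fun p : EuclideanSpace ℝ (Fin 4) => (a ^ 2)⁻¹ * p 0 := by fun_prop
  exact h0.continuousOn.mul ((((h2.continuousOn.mul hρ).neg).add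
    ((hx.continuousOn.mul h1.continuousOn).mul hτ)).sub
    ((continuousOn_const.mul hτ).mul h0.continuousOn))

lemma exists_gluePoly_pos (i : Fin 3) : ∃ s : ℝ, s ^ 2 < 1 ∧ 0 < gluePoly i s :=
  match i with
  | 0 => ⟨1 / 2, by norm_num, by rw [gluePoly_zero]; norm_num⟩
  | 1 => ⟨-1 / 2, by norm_num, by rw [gluePoly_one]; norm_num⟩
  | 2 => ⟨0, by norm_num, by rw [gluePoly_two]; norm_num⟩

lemma integral_energyDensity_neg (ha : 0 < a) (hc : 0 < c) (hd : 0 < d)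
    (hneg : ∀ p ∈ planarSphereTwo a b c d, ∀ i, 0 < bump i (p 0 / a) → bumpRatio a b c d i p < 0)
    {v : Fin 3 → ℝ} (hv : v ≠ 0) :
    ∫ p in planarSphereTwo a b c d, energyDensity a b c d v p ∂μHE[2] < 0 := by
  have hterm : ∀ p ∈ planarSphereTwo a b c d, ∀ i,
      v i ^ 2 * bump i (p 0 / a) ^ 2 * bumpRatio a b c d i p ≤ 0 := by
    intro p hp i
    rcases (bump_nonneg i (p 0 / a)).eq_or_lt with h | h
    · simp [← h]
    · exact mul_nonpos_of_nonneg_of_nonpos (by positivity) (hneg p hp i h).le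
  obtain ⟨i, hi⟩ : ∃ i, v i ≠ 0 := by
    by_contra! h
    exact hv (funext h)
  obtain ⟨s₀, hs₀, hgs₀⟩ := exists_gluePoly_pos i
  have hpos := euclideanHausdorffMeasure_planarSphereTwo_inter_pos (b := b) (c := c) ha hd
    (contDiff_bump i).continuous hs₀ (bump_pos_iff.2 hgs₀)
  have hm := (isClosed_planarSphereTwo a b c d).measurableSet
  have h := (setIntegral_pos_iff_support_of_nonneg_ae (μ := μHE[2])
    (s := planarSphereTwo a b c d) (f := fun p => -energyDensity a b c d v p)
    ((ae_restrict_iff' hm).2 (Filter.Eventually.of_forall fun p hp => ?_))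
    (integrableOn_planarSphereTwo ha hc hd (continuousOn_energyDensity a b c d v)).neg).2
    (hpos.trans_le (measure_mono ?_))
  · rw [integral_neg] at h
    linarith
  · change 0 ≤ -energyDensity a b c d v p
    rw [energyDensity_eq_sum, neg_nonneg]
    exact Finset.sum_nonpos fun j _ => hterm p hp j
  · rintro p ⟨hp, hbp⟩
    refine ⟨?_, hp⟩
    have hbp' : 0 < bump i (p 0 / a) := hbp
    have hlt : energyDensity a b c d v p < 0 := by
      rw [energyDensity_eq_sum]
      refine Finset.sum_neg' (fun j _ => hterm p hp j) ⟨i, Finset.mem_univ i, ?_⟩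
      exact mul_neg_of_pos_of_neg (by positivity) (hneg p hp i hbp')
    exact (neg_pos.2 hlt).ne'

end TestFunctions

end

theorem proposition9p2 (b c d : ℝ) (hd : 0 < d) (hcd : d < c) (hbc : c < b) :
    ∃ a₀ : ℝ, b < a₀ ∧ ∀ a : ℝ, a₀ < a →
      2 < SubmanifoldGeometry.morseIndex (ellipsoid a b c d) (planarSphereTwo a b c d) := by
  obtain ⟨a₀, hba₀, h⟩ := exists_bumpRatio_neg hd hcd hbc
  refine ⟨a₀, hba₀, fun a ha => ?_⟩
  have hc : 0 < c := hd.trans hcd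
  have hb : 0 < b := hc.trans hbc
  have ha0 : 0 < a := hb.trans (hba₀.trans ha)
  have h3 := SubmanifoldGeometry.le_morseIndex (M := ellipsoid a b c d)
    (testFunction a b c d) fun v hv => by
      rw [stabilityForm_testFunction ha0 hb hc hd v]
      exact integral_energyDensity_neg ha0 hc hd (h a ha) hv
  exact lt_of_lt_of_le (by norm_num) h3
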